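/- A rooted planar map $(M,e)$ is a connected planar graph $M$ (self-loops and multiple edges allowed) embedded in the sphere, considered up to isotopic deformation (equivalently, up to orientation-preserving homeomorphism of the sphere), with a distinguished directed edge $e$. For $n\ge 1$ let $\mathcal M_n$ be the finite set of rooted planar maps with $n$ edges, and let $\mathbb P^0_n$ be the uniform distribution on the triples $(M,e,T)$ where $(M,e)\in\mathcal M_n$ and $T$ is a spanning tree of $M$, so that under $\mathbb P^0_n$ each $(M,e)\in\mathcal M_n$ has probability proportional to its number of spanning trees. Write $\mathbb E^0_n$ for the expectation with respect to $\mathbb P^0_n$, and $V(M)$, $E(M)$ for the sets of vertices and edges of $M$. Then for every fixed real number $k>0$, $$\lim_{n\to\infty}\mathbb E^0_n\left[\left(\frac{|E(M)|}{2|V(M)|}\right)^k\right]=1 .$$ -/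

import Mathlib

open Filter Topology MeasureTheory ProbabilityTheory

/-- A graph (self-loops and multiple edges allowed, no isolated vertices) embedded in a closed
oriented surface up to orientation-preserving homeomorphism, encoded by its rotation system on
the set `D` of directed edges (darts): `next` sends a dart to the following dart, in the
cyclic order, around the same source vertex, and `rev` reverses the direction of a dart. -/
structure CombMap (D : Type*) where
  next : Equiv.Perm D
  rev : Equiv.Perm D
  rev_rev : ∀ d, rev (rev d) = d
  rev_ne : ∀ d, rev d ≠ d

namespace CombMap

variable {D : Type*} (M : CombMap D)

/-- Vertices are the cycles (fixed points included) of `next`. -/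
def Vertex : Type _ := Quotient (Equiv.Perm.SameCycle.setoid M.next)

/-- Undirected edges are the pairs `{d, rev d}`, that is, the cycles of `rev`. -/
def Edge : Type _ := Quotient (Equiv.Perm.SameCycle.setoid M.rev)

/-- Faces are the cycles of the face-tracing permutation `next ∘ rev`. -/
def Face : Type _ := Quotient (Equiv.Perm.SameCycle.setoid (M.next * M.rev))

/-- The source vertex of a dart. -/
def source (d : D) : M.Vertex := Quotient.mk _ d

/-- The destination vertex of a dart. -/
def target (d : D) : M.Vertex := M.source (M.rev d)

/-- The undirected edge that underlies a dart. -/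
def edge (d : D) : M.Edge := Quotient.mk _ d

/-- The spanning subgraph with edge set `S` is connected: any two vertices of the map are joined
by a path that uses edges of `S` only. -/
def ConnectedBy (S : Set M.Edge) : Prop :=
  ∀ u v : M.Vertex, Relation.ReflTransGen
    (fun a b => ∃ d : D, M.edge d ∈ S ∧ M.source d = a ∧ M.target d = b) u v

/-- The spanning subgraph with edge set `S` contains a cycle: consecutive (in the cyclic order of
`Fin (k + 1)`, where `+ 1` wraps around) directed edges `c 0, …, c k` with distinct vertices and
distinct edges. A self-loop is a cycle of length 1, two parallel edges form one of length 2. -/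
def HasCycle (S : Set M.Edge) : Prop :=
  ∃ (k : ℕ) (c : Fin (k + 1) → D),
    (∀ i, M.edge (c i) ∈ S) ∧ (∀ i, M.target (c i) = M.source (c (i + 1))) ∧
    Function.Injective (fun i => M.source (c i)) ∧ Function.Injective (fun i => M.edge (c i))

/-- Edge sets of spanning trees: the spanning subgraph is connected and has no cycles. -/
def IsSpanningTree (T : Set M.Edge) : Prop :=
  M.ConnectedBy T ∧ ¬ M.HasCycle T

/-- The map is a connected map on the sphere: the graph is connected, and the surface has
genus zero by Euler's formula `V - E + F = 2`. -/
def IsPlanar : Prop :=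
  M.ConnectedBy Set.univ ∧ Nat.card M.Vertex + Nat.card M.Face = Nat.card M.Edge + 2

end CombMap

/-- A planar map with `n` edges, whose `2 n` directed edges are labelled by `Fin (2 * n)`,
together with a distinguished directed edge `root`. -/
structure LabelledRootedMap (n : ℕ) extends CombMap (Fin (2 * n)) where
  planar : toCombMap.IsPlanar
  root : Fin (2 * n)

/-- Two labelled rooted planar maps are equivalent if they differ by a relabelling of the directed
edges (that is, by an orientation-preserving homeomorphism of the sphere that respects roots). -/
instance LabelledRootedMap.setoid (n : ℕ) : Setoid (LabelledRootedMap n) where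
  r M N := ∃ f : Equiv.Perm (Fin (2 * n)),
    (∀ d, f (M.next d) = N.next (f d)) ∧ (∀ d, f (M.rev d) = N.rev (f d)) ∧ f M.root = N.root
  iseqv :=
    { refl := fun _ => ⟨Equiv.refl _, fun _ => rfl, fun _ => rfl, rfl⟩
      symm := by
        rintro M N ⟨f, h1, h2, h3⟩
        refine ⟨f.symm, fun d => ?_, fun d => ?_, ?_⟩
        · rw [Equiv.symm_apply_eq, h1, Equiv.apply_symm_apply]
        · rw [Equiv.symm_apply_eq, h2, Equiv.apply_symm_apply]
        · rw [Equiv.symm_apply_eq, h3]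
      trans := by
        rintro M N P ⟨f, h1, h2, h3⟩ ⟨g, k1, k2, k3⟩
        exact ⟨f.trans g, fun d => by simp [h1, k1], fun d => by simp [h2, k2],
          by simp [h3, k3]⟩ }

/-- The set of rooted planar maps with `n` edges. -/
def RootedPlanarMap (n : ℕ) : Type := Quotient (LabelledRootedMap.setoid n)

namespace RootedPlanarMap

variable {n : ℕ}

/-- A concrete realization of a rooted planar map, by some labelling of its directed edges. -/
noncomputable def rep (M : RootedPlanarMap n) : LabelledRootedMap n := Quotient.out M

/-- The number `|V(M)|` of vertices (it does not depend on the realization). -/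
noncomputable def numVertices (M : RootedPlanarMap n) : ℕ := Nat.card M.rep.Vertex

/-- The number `|E(M)|` of edges (it does not depend on the realization). -/
noncomputable def numEdges (M : RootedPlanarMap n) : ℕ := Nat.card M.rep.Edge

/-- The set of spanning trees of a rooted planar map, each given by its set of edges. -/
def SpanningTree (M : RootedPlanarMap n) : Type := {T : Set M.rep.Edge // M.rep.IsSpanningTree T}

end RootedPlanarMap

/-- Rooted planar maps with `n` edges equipped with a spanning tree. -/
def TreeRootedMap (n : ℕ) : Type := Σ M : RootedPlanarMap n, M.SpanningTree

/-- Every set of (finitely many) tree-decorated maps is an event. -/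
instance (n : ℕ) : MeasurableSpace (TreeRootedMap n) := ⊤

/-- The law `P⁰ₙ`: the uniform distribution on rooted planar maps with `n` edges equipped with a
spanning tree. Under it, a rooted map has probability proportional to its number of spanning
trees. -/
noncomputable def treeRootedLaw (n : ℕ) : Measure (TreeRootedMap n) :=
  uniformOn Set.univ

/-! The walk around a spanning tree (Mullin's bijection) lists the `2 * n` darts in a single cycle,
started at the root. In this labelling, reversing the tree darts and reversing the other darts
become involutions `p` and `q` of `Fin (2 * n)` with complementary supports; vertices are the cycles
of `finRotate * p`, faces those of `finRotate * q`. A rotation times an involution with `c` arcs has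
at most `c + 1` cycles, with equality exactly when no two arcs cross. Euler's formula therefore
forces both involutions to be noncrossing (`exists_realizes`), and for `n > 0` every such pair comes
from a tree-rooted map (`TreeRootedMap.exists_of_isCode`). If `T` is the support of `p`, then `2 |V|
= |T| + 2`.

A noncrossing involution is determined by its openers and closers, so a tree-rooted map is
determined by two subsets of `Fin (2 * n)`: its support `T` and its set of openers. This gives at
most `16 ^ n` maps. Conversely, each even `T` carries a product of two Catalan numbers of codes, so
there are at least `16 ^ n / (8 (n + 1) ^ 4)` of them (`sixteen_pow_le_card`).

By a Chernoff bound (`card_deviation_le`), at most `2 * 16 ^ n * exp (-δ² n)` pairs of subsets have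
`|T|` at distance `δ n` or more from `n`. Polynomial losses are harmless against this: the
exceptional maps have probability `O(n ^ 4 exp (-δ² n))`, and since `n / (|T| + 2) ≤ n` they
contribute `O(n ^ (k + 4) exp (-δ² n))` to the expectation. On the other maps the ratio is close to
1. -/

/-! ### Walking around a subgraph; the contour of a spanning tree. -/

namespace CombMap

variable {D : Type*} (M : CombMap D)

theorem source_eq_iff {d d' : D} : M.source d = M.source d' ↔ M.next.SameCycle d d' :=
  Quotient.eq (r := Equiv.Perm.SameCycle.setoid M.next)

theorem source_next (d : D) : M.source (M.next d) = M.source d :=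
  M.source_eq_iff.2 (Equiv.Perm.sameCycle_apply_left.2 .rfl)

theorem edge_eq_iff {d d' : D} : M.edge d = M.edge d' ↔ d' = d ∨ d' = M.rev d := by
  refine (Quotient.eq (r := Equiv.Perm.SameCycle.setoid M.rev)).trans ⟨?_, ?_⟩
  · rintro ⟨i, rfl⟩
    have h2 : M.rev * M.rev = 1 := Equiv.ext M.rev_rev
    rcases Int.even_or_odd' i with ⟨j, rfl | rfl⟩
    · left; rw [zpow_mul, zpow_ofNat, pow_two, h2]; simp
    · right; rw [zpow_add, zpow_mul, zpow_ofNat, pow_two, h2]; simp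
  · rintro (rfl | rfl)
    · exact .rfl
    · exact Equiv.Perm.sameCycle_apply_right.2 .rfl

theorem edge_rev (d : D) : M.edge (M.rev d) = M.edge d :=
  (M.edge_eq_iff.2 (Or.inr rfl)).symm

open Classical in
/-- The involution that reverses the darts of the edges in `T` and fixes all other darts. -/
noncomputable def revOn (T : Set M.Edge) : Equiv.Perm D :=
  Function.Involutive.toPerm (fun d => if M.edge d ∈ T then M.rev d else d) (by
    intro d
    by_cases h : M.edge d ∈ T
    · simp [h, edge_rev, M.rev_rev]
    · simp [h])

variable {M} {T : Set M.Edge} {d : D}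

theorem revOn_of_mem (h : M.edge d ∈ T) : M.revOn T d = M.rev d :=
  if_pos h

theorem revOn_of_notMem (h : M.edge d ∉ T) : M.revOn T d = d :=
  if_neg h

theorem edge_revOn (T : Set M.Edge) (d : D) : M.edge (M.revOn T d) = M.edge d := by
  by_cases h : M.edge d ∈ T
  · rw [revOn_of_mem h, edge_rev]
  · rw [revOn_of_notMem h]

theorem revOn_revOn (T : Set M.Edge) (d : D) : M.revOn T (M.revOn T d) = d := by
  by_cases h : M.edge d ∈ T
  · rw [revOn_of_mem h, revOn_of_mem (by rwa [edge_rev]), M.rev_rev]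
  · rw [revOn_of_notMem h, revOn_of_notMem h]

theorem revOn_ne_iff : M.revOn T d ≠ d ↔ M.edge d ∈ T := by
  by_cases h : M.edge d ∈ T
  · simp [revOn_of_mem h, h, M.rev_ne]
  · simp [revOn_of_notMem h, h]

theorem revOn_compl_revOn (T : Set M.Edge) (d : D) : M.revOn Tᶜ (M.revOn T d) = M.rev d := by
  by_cases h : M.edge d ∈ T
  · rw [revOn_of_mem h, revOn_of_notMem (by rw [edge_rev]; simpa using h)]
  · rw [revOn_of_notMem h, revOn_of_mem h]

variable (M) in
/-- The permutation that walks around the subgraph `T`, following the edges of `T` and crossing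
the other ones. -/
noncomputable def contour (T : Set M.Edge) : Equiv.Perm D := M.next * M.revOn T

theorem contour_revOn (T : Set M.Edge) (d : D) : M.contour T (M.revOn T d) = M.next d := by
  simp [contour, revOn_revOn]

/-- Duality: the one contour, composed with the reversal of the darts in `T`, gives the vertices,
and with that of the other darts the faces. -/
theorem contour_revOn_compl (T : Set M.Edge) (d : D) :
    M.contour T (M.revOn Tᶜ d) = M.next (M.rev d) := by
  have := revOn_compl_revOn Tᶜ d
  rw [compl_compl] at this
  simp [contour, this]

theorem ConnectedBy.mono {S : Set M.Edge} (h : M.ConnectedBy S) (hST : S ⊆ T) :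
    M.ConnectedBy T := fun u v =>
  Relation.ReflTransGen.mono (by rintro _ _ ⟨d, hd, h1, h2⟩; exact ⟨d, hST hd, h1, h2⟩) _ _ (h u v)

theorem forall_source_eq [Finite D] {P : D → Prop} (hn : ∀ d, P d → P (M.next d)) {d d' : D}
    (h : M.source d = M.source d') (hd : P d) : P d' := by
  obtain ⟨i, rfl⟩ := (M.source_eq_iff.1 h).exists_nat_pow_eq
  clear h
  induction i with
  | zero => simpa using hd
  | succ i ih => rw [pow_succ']; exact hn _ ih

theorem ConnectedBy.induction [Finite D] (hT : M.ConnectedBy T) {P : D → Prop} {r : D} (hr : P r)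
    (hn : ∀ d, P d → P (M.next d)) (hrev : ∀ d, M.edge d ∈ T → P d → P (M.rev d)) (d : D) :
    P d := by
  have key : ∀ v, Relation.ReflTransGen
      (fun a b => ∃ d : D, M.edge d ∈ T ∧ M.source d = a ∧ M.target d = b) (M.source r) v →
      ∀ d, M.source d = v → P d := by
    intro v hv
    induction hv with
    | refl => exact fun d hd => forall_source_eq hn hd.symm hr
    | tail _ hbc ih =>
      obtain ⟨e, he, h1, h2⟩ := hbc
      exact fun d hd => forall_source_eq hn (h2.trans hd.symm) (hrev e he (ih e h1))
  exact key _ (hT _ _) d rfl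

/-- A path between the ends of an edge of `T` that avoids this edge closes up to a cycle. -/
theorem hasCycle_of_reflTransGen {d₀ : D} (h₀ : M.edge d₀ ∈ T)
    (h : Relation.ReflTransGen
      (fun a b => ∃ d : D, M.edge d ∈ T \ {M.edge d₀} ∧ M.source d = a ∧ M.target d = b)
      (M.target d₀) (M.source d₀)) : M.HasCycle T := by
  -- Dropping loops and multiplicities lets the walk be shortened to a path with distinct vertices.
  let G : SimpleGraph M.Vertex :=
    { Adj := fun a b => a ≠ b ∧ ∃ d : D, M.edge d ∈ T \ {M.edge d₀} ∧ M.source d = a ∧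
        M.target d = b
      symm := ⟨by
        rintro a b ⟨hab, d, hd, h1, h2⟩
        exact ⟨hab.symm, M.rev d, by rwa [edge_rev], h2, by rw [target, M.rev_rev, h1]⟩⟩
      loopless := ⟨fun a h => h.1 rfl⟩ }
  have hreach : G.Reachable (M.target d₀) (M.source d₀) := by
    generalize M.source d₀ = w at h
    induction h with
    | refl => exact .refl _
    | @tail b c _ hbc ih =>
      by_cases hb : b = c
      · exact hb ▸ ih
      · exact ih.trans (SimpleGraph.Adj.reachable (G := G) ⟨hb, hbc⟩)
  obtain ⟨p, hp⟩ := hreach.exists_isPath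
  have hadj : ∀ i : ℕ, i < p.length → ∃ d : D, M.edge d ∈ T \ {M.edge d₀} ∧
      M.source d = p.getVert i ∧ M.target d = p.getVert (i + 1) :=
    fun i hi => (p.adj_getVert_succ hi).2
  have : Nonempty D := ⟨d₀⟩
  choose! e he hs ht using hadj
  let c : Fin (p.length + 1) → D := fun i => if (i : ℕ) < p.length then e i else d₀
  have hsrc : ∀ i, M.source (c i) = p.getVert i := by
    intro i
    by_cases hi : (i : ℕ) < p.length
    · simp only [c, if_pos hi, hs _ hi]
    · have : (i : ℕ) = p.length := by omega
      simp only [c, if_neg hi, this, SimpleGraph.Walk.getVert_length]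
  have hinj : Function.Injective (fun i => M.source (c i)) := by
    intro i j hij
    simp only [hsrc] at hij
    exact Fin.ext (hp.getVert_injOn (by simp; omega) (by simp; omega) hij)
  have hedge : ∀ i : Fin (p.length + 1), (i : ℕ) < p.length → M.edge (c i) ∈ T \ {M.edge d₀} := by
    intro i hi
    simp only [c, if_pos hi, he _ hi]
  have hlast : ∀ i : Fin (p.length + 1), ¬ (i : ℕ) < p.length → c i = d₀ := fun i hi => if_neg hi
  have htgt : ∀ i : Fin (p.length + 1), (i : ℕ) < p.length →
      M.target (c i) = p.getVert (i + 1) := by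
    intro i hi
    simp only [c, if_pos hi, ht _ hi]
  refine ⟨p.length, c, fun i => ?_, fun i => ?_, hinj, fun i j hij => ?_⟩
  · by_cases hi : (i : ℕ) < p.length
    · exact (hedge i hi).1
    · rwa [hlast i hi]
  · rw [hsrc]
    by_cases hi : (i : ℕ) < p.length
    · rw [htgt i hi, Fin.val_add_one_of_lt (by simpa [Fin.lt_def] using hi)]
    · have : i = Fin.last _ := Fin.ext (by simp; omega)
      rw [hlast i hi, this, Fin.last_add_one]
      simp
  · simp only at hij
    rcases M.edge_eq_iff.1 hij with h1 | h1
    · exact hinj (congrArg M.source h1.symm)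
    · by_cases hi : (i : ℕ) < p.length
      · by_cases hj : (j : ℕ) < p.length
        · have a1 : p.getVert j = p.getVert (i + 1) := by
            rw [← htgt i hi, ← hsrc, h1]; rfl
          have a2 : p.getVert i = p.getVert (j + 1) := by
            rw [← htgt j hj, ← hsrc, target, h1, M.rev_rev]
          have b1 := hp.getVert_injOn (by simp; omega) (by simp; omega) a1
          have b2 := hp.getVert_injOn (by simp; omega) (by simp; omega) a2
          omega
        · exact absurd (by rw [hij, hlast j hj]; rfl) (hedge i hi).2
      · by_cases hj : (j : ℕ) < p.length
        · exact absurd (by rw [← hij, hlast i hi]; rfl) (hedge j hj).2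
        · exact Fin.ext (by omega)

/-- Removing an edge from a forest separates its two ends. -/
theorem exists_cut (hT : ¬ M.HasCycle T) {d₀ : D} (h₀ : M.edge d₀ ∈ T) :
    ∃ A : Set D, d₀ ∉ A ∧ M.rev d₀ ∈ A ∧ (∀ d, M.next d ∈ A ↔ d ∈ A) ∧
      ∀ d, M.edge d ∈ T → M.edge d ≠ M.edge d₀ → d ∈ A → M.rev d ∈ A := by
  refine ⟨{d | Relation.ReflTransGen
      (fun a b => ∃ d : D, M.edge d ∈ T \ {M.edge d₀} ∧ M.source d = a ∧ M.target d = b)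
      (M.target d₀) (M.source d)}, fun h => hT (hasCycle_of_reflTransGen h₀ h), .refl,
      fun d => by simp [source_next], fun d hd hne h => ?_⟩
  exact h.tail ⟨d, ⟨hd, hne⟩, rfl, rfl⟩

/-- Sum over the side `A` of the cut made by the edge of `d₀`. Invariance turns `v ∘ revOn T` into
`v ∘ next`, and `next` permutes `A`, so `v ∘ revOn T` and `v` have the same sum. As `revOn T`
permutes `A` without `rev d₀`, the two remaining terms, `v d₀` and `v (rev d₀)`, agree. -/
theorem contour_invariant_rev [Finite D] (hT : ¬ M.HasCycle T) {v : D → ℚ}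
    (hv : ∀ d, v (M.contour T d) = v d) {d₀ : D} (h₀ : M.edge d₀ ∈ T) :
    v (M.rev d₀) = v d₀ := by
  classical
  cases nonempty_fintype D
  obtain ⟨A, h1, h2, h3, h4⟩ := exists_cut hT h₀
  have hrev : ∀ d, M.edge d = M.edge d₀ → d ∈ A → d = M.rev d₀ := by
    intro d hd hdA
    rcases M.edge_eq_iff.1 hd.symm with rfl | h
    · exact absurd hdA h1
    · exact h
  let F : Finset D := Finset.univ.filter (· ∈ A)
  have hF : ∀ d, d ∈ F ↔ d ∈ A := by simp [F]
  have hnext : ∀ d, v (M.next d) = v (M.revOn T d) := fun d => by rw [← contour_revOn T, hv]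
  have s1 : ∑ d ∈ F, v (M.revOn T d) = ∑ d ∈ F, v d := by
    simp only [← hnext]
    exact Finset.sum_equiv M.next (fun d => by rw [hF, hF, h3]) (fun _ _ => rfl)
  have key : ∀ d, d ∈ F.erase (M.rev d₀) → M.revOn T d ∈ F.erase (M.rev d₀) := by
    intro d hd
    rw [Finset.mem_erase, hF] at hd ⊢
    have hne : M.edge d ≠ M.edge d₀ := fun h => hd.1 (hrev d h hd.2)
    refine ⟨fun h => hne ?_, ?_⟩
    · rw [← edge_revOn T, h, edge_rev]
    · by_cases h : M.edge d ∈ T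
      · rw [revOn_of_mem h]; exact h4 d h hne hd.2
      · rw [revOn_of_notMem h]; exact hd.2
  have s2 : ∑ d ∈ F.erase (M.rev d₀), v (M.revOn T d) = ∑ d ∈ F.erase (M.rev d₀), v d :=
    Finset.sum_equiv (M.revOn T)
      (fun d => ⟨key d, fun h => by have := key _ h; rwa [revOn_revOn] at this⟩) (fun _ _ => rfl)
  have hm : M.rev d₀ ∈ F := (hF _).2 h2
  rw [← Finset.add_sum_erase F _ hm, ← Finset.add_sum_erase F v hm, s2,
    revOn_of_mem (by rwa [edge_rev]), M.rev_rev] at s1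
  linarith

/-- The contour of a spanning tree is a single cycle. -/
theorem IsSpanningTree.sameCycle_contour [Finite D] (hT : M.IsSpanningTree T) (r d : D) :
    (M.contour T).SameCycle r d := by
  classical
  -- The indicator of one contour cycle is also invariant under tree reversals, hence under `next`,
  -- hence constant by connectedness.
  let v : D → ℚ := fun d => if (M.contour T).SameCycle r d then 1 else 0
  have hv : ∀ d, v (M.contour T d) = v d := fun d => by
    simp only [v, Equiv.Perm.sameCycle_apply_right]
  have hrev : ∀ d, M.edge d ∈ T → v (M.rev d) = v d := fun d hd =>
    contour_invariant_rev hT.2 hv hd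
  have : v d = 1 := by
    refine hT.1.induction (P := fun d => v d = 1) (r := r) (by simp [v, Equiv.Perm.SameCycle.rfl]) (fun d hd => ?_)
      (fun d hd h => by rw [hrev d hd, h]) d
    rw [← contour_revOn T, hv]
    by_cases h : M.edge d ∈ T
    · rw [revOn_of_mem h, hrev d h, hd]
    · rw [revOn_of_notMem h, hd]
  by_contra hcon
  simp [v, hcon] at this

end CombMap

/-! ### Bounding cycle counts by linear algebra. -/

/-- The number of cycles of a permutation, fixed points included. -/
noncomputable def numCycles {D : Type*} (f : Equiv.Perm D) : ℕ :=
  Nat.card (Quotient (Equiv.Perm.SameCycle.setoid f))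

theorem numCycles_congr {D D' : Type*} {f : Equiv.Perm D} {g : Equiv.Perm D'} (e : D ≃ D')
    (h : ∀ d, e (f d) = g (e d)) : numCycles f = numCycles g := by
  refine Nat.card_congr (Quotient.congr e fun a b => ?_)
  have hpow : ∀ (i : ℤ) d, e ((f ^ i) d) = (g ^ i) (e d) := by
    intro i d
    have hg : g = e.permCongr f := by
      ext x; simp [Equiv.permCongr_apply, h]
    have := map_zpow e.permCongrHom f i
    rw [hg]
    change _ = (((e.permCongrHom f) ^ i : Equiv.Perm D')) (e d)
    rw [← this]
    simp [Equiv.permCongrHom, Equiv.permCongr_apply]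
  constructor
  · rintro ⟨i, rfl⟩
    exact ⟨i, (hpow i a).symm⟩
  · rintro ⟨i, hi⟩
    exact ⟨i, e.injective (by rw [hpow, hi])⟩

/-- If the functions that are invariant under `f` and agree at `c` and `g c` for `c ∈ C` are all
constant, then `f` has at most `|C| + 1` cycles. -/
theorem numCycles_le_card_add_one {D : Type*} [Finite D] (f : Equiv.Perm D) (C : Finset D)
    (g : D → D)
    (H : ∀ v : D → ℚ, (∀ d, v (f d) = v d) → (∀ c ∈ C, v c = v (g c)) → ∀ d d', v d = v d') :
    numCycles f ≤ C.card + 1 := by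
  classical
  cases nonempty_fintype D
  let Q := Quotient (Equiv.Perm.SameCycle.setoid f)
  let mk : D → Q := Quotient.mk _
  have hmk : ∀ d, mk (f d) = mk d := fun d =>
    Quotient.sound (s := Equiv.Perm.SameCycle.setoid f) (Equiv.Perm.sameCycle_apply_left.2 .rfl)
  have : Fintype Q := Fintype.ofFinite _
  -- Rank-nullity: the kernel consists of constants and the target has dimension `|C|`.
  let φ : (Q → ℚ) →ₗ[ℚ] (C → ℚ) :=
    { toFun := fun w c => w (mk c) - w (mk (g c))
      map_add' := fun _ _ => by ext; simp; ring
      map_smul' := fun _ _ => by ext; simp; ring }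
  have hker : Module.finrank ℚ (LinearMap.ker φ) ≤ 1 := by
    refine finrank_le_one (⟨fun _ => 1, by ext; simp [φ]⟩ : LinearMap.ker φ) ?_
    rintro ⟨w, hw⟩
    have hc : ∀ d d', w (mk d) = w (mk d') :=
      H (fun d => w (mk d)) (fun d => by simp only [hmk])
        (fun c hc => sub_eq_zero.1 (congrFun (LinearMap.mem_ker.1 hw) ⟨c, hc⟩))
    rcases isEmpty_or_nonempty D with hD | ⟨⟨d⟩⟩
    · refine ⟨0, Subtype.ext (funext fun q => ?_)⟩
      induction q using Quotient.inductionOn with | _ d => exact hD.elim d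
    · refine ⟨w (mk d), Subtype.ext (funext fun q => ?_)⟩
      induction q using Quotient.inductionOn with | _ d' =>
      simpa using hc d d'
  have hrange : Module.finrank ℚ (LinearMap.range φ) ≤ C.card := by
    refine (Submodule.finrank_le _).trans ?_
    simp
  have := φ.finrank_range_add_finrank_ker
  rw [Module.finrank_fintype_fun_eq_card] at this
  rw [numCycles, Nat.card_eq_fintype_card]
  change Fintype.card Q ≤ _
  omega

/-! ### Noncrossing involutions and the genus inequality. -/

section Fin

variable {m : ℕ} {p q : Equiv.Perm (Fin m)}

theorem val_finRotate (d : Fin m) :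
    (finRotate m d : ℕ) = if (d : ℕ) + 1 = m then 0 else (d : ℕ) + 1 := by
  cases m with
  | zero => exact d.elim0
  | succ m => rw [coe_finRotate]; simp [Fin.ext_iff]

/-- The larger ends of the arcs of an involution. -/
def closers (p : Equiv.Perm (Fin m)) : Finset (Fin m) := Finset.univ.filter fun d => p d < d

/-- No two arcs of an involution cross. -/
def Noncrossing (p : Equiv.Perm (Fin m)) : Prop :=
  ∀ i j, i < j → j < p i → i < p j ∧ p j < p i

theorem mem_closers {d : Fin m} : d ∈ closers p ↔ p d < d := by simp [closers]

theorem two_mul_card_closers (hp : ∀ d, p (p d) = d) :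
    2 * (closers p).card = (Finset.univ.filter fun d => p d ≠ d).card := by
  have h1 : (Finset.univ.filter fun d => d < p d).card = (closers p).card :=
    Finset.card_equiv p fun d => by simp [closers, hp]
  have h2 : (Finset.univ.filter fun d => p d ≠ d) =
      (Finset.univ.filter fun d => d < p d) ∪ closers p := by
    ext d
    simp only [closers, Finset.mem_filter, Finset.mem_univ, true_and, Finset.mem_union]
    rw [or_comm]; exact lt_or_lt_iff_ne.symm
  rw [h2, Finset.card_union_of_disjoint, h1]
  · omega
  · rw [Finset.disjoint_left]
    intro d hd
    simp only [closers, Finset.mem_filter, Finset.mem_univ, true_and] at hd ⊢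
    exact hd.not_gt

/-- A fixed-point-free involution has one cycle for each closer. -/
theorem numCycles_involution (hp : ∀ d, p (p d) = d) (hne : ∀ d, p d ≠ d) :
    numCycles p = (closers p).card := by
  have hs : ∀ d d', p.SameCycle d d' ↔ d' = d ∨ d' = p d := by
    intro d d'
    constructor
    · rintro ⟨i, rfl⟩
      have h2 : p * p = 1 := Equiv.ext hp
      rcases Int.even_or_odd' i with ⟨j, rfl | rfl⟩
      · left; rw [zpow_mul, zpow_ofNat, pow_two, h2]; simp
      · right; rw [zpow_add, zpow_mul, zpow_ofNat, pow_two, h2]; simp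
    · rintro (rfl | rfl)
      · exact .rfl
      · exact Equiv.Perm.sameCycle_apply_right.2 .rfl
  let F : closers p → Quotient (Equiv.Perm.SameCycle.setoid p) := fun d => Quotient.mk _ d.1
  have hF : Function.Bijective F := by
    constructor
    · rintro ⟨a, ha⟩ ⟨b, hb⟩ hab
      rw [mem_closers] at ha hb
      rcases (hs a b).1 (Quotient.exact hab) with h | h
      · exact Subtype.ext h.symm
      · rw [h, hp] at hb
        exact absurd ha hb.not_gt
    · intro x
      induction x using Quotient.inductionOn with | _ d =>
      rcases lt_or_gt_of_ne (hne d) with h | h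
      · exact ⟨⟨d, mem_closers.2 h⟩, rfl⟩
      · refine ⟨⟨p d, mem_closers.2 (by rwa [hp])⟩, Quotient.sound ?_⟩
        exact (hs _ _).2 (Or.inr (hp d).symm)
  rw [numCycles, ← Nat.card_congr (Equiv.ofBijective F hF)]
  simp

theorem eq_of_forall_succ {u : ℕ → ℚ} {l r : ℕ} (h : ∀ k, l ≤ k → k < r → u (k + 1) = u k)
    {k : ℕ} (h1 : l ≤ k) (h2 : k ≤ r) : u k = u l := by
  induction k, h1 using Nat.le_induction with
  | base => rfl
  | succ k hk ih => rw [h k hk (by omega), ih (by omega)]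

/-- One constraint per arc suffices: a function invariant under `finRotate * p` and under `p` is
invariant under the rotation, hence constant. -/
theorem numCycles_finRotate_mul_le (hp : ∀ d, p (p d) = d) :
    numCycles (finRotate m * p) ≤ (closers p).card + 1 := by
  refine numCycles_le_card_add_one _ _ p fun v hv hc => ?_
  have hc' : ∀ d, v (p d) = v d := by
    intro d
    rcases lt_trichotomy (p d) d with h | h | h
    · exact (hc d (mem_closers.2 h)).symm
    · rw [h]
    · have := hc (p d) (mem_closers.2 (by rwa [hp])); rwa [hp] at this
  have hr : ∀ d, v (finRotate m d) = v d := by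
    intro d
    have := hv (p d)
    rwa [Equiv.Perm.mul_apply, hp, hc'] at this
  have h0 : ∀ d d' : Fin m, (d' : ℕ) = 0 → v d = v d' := by
    rintro ⟨d, hd⟩
    induction d with
    | zero => intro d' h; congr 1; exact Fin.ext h.symm
    | succ d ih =>
      intro d' h
      rw [← ih (by omega) d' h, ← hr ⟨d, _⟩]
      congr 1
      ext
      rw [val_finRotate]
      simp; omega
  intro d d'
  rw [h0 d ⟨0, by have := d.2; omega⟩ rfl, h0 d' ⟨0, by have := d.2; omega⟩ rfl]

/-- The constraints of two crossing arcs are superfluous. The others make an invariant function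
constant on each of the four circular intervals cut out by the ends `a`, `x`, `p a`, `p x`, and
invariance at these ends already identifies the four values. -/
theorem numCycles_lt_of_crossing (hp : ∀ d, p (p d) = d) {a x : Fin m} (hax : a < x)
    (hxb : x < p a) (hby : p a < p x) :
    numCycles (finRotate m * p) ≤ (closers p).card := by
  have hb : p a ∈ closers p := mem_closers.2 (by rw [hp]; exact hax.trans hxb)
  have hy : p x ∈ (closers p).erase (p a) :=
    Finset.mem_erase.2 ⟨hby.ne', mem_closers.2 (by rw [hp]; exact hxb.trans hby)⟩
  have hcard := Finset.card_erase_add_one hy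
  have hcard' := Finset.card_erase_add_one hb
  suffices numCycles (finRotate m * p) ≤ (((closers p).erase (p a)).erase (p x)).card + 1 by omega
  refine numCycles_le_card_add_one _ _ p fun v hv hc => ?_
  have hv' : ∀ d, v (finRotate m d) = v (p d) := by
    intro d
    have := hv (p d)
    rwa [Equiv.Perm.mul_apply, hp] at this
  have hc' : ∀ d, d ≠ a → d ≠ x → d ≠ p a → d ≠ p x → v (finRotate m d) = v d := by
    intro d h1 h2 h3 h4
    rw [hv']
    rcases lt_trichotomy (p d) d with h | h | h
    · exact (hc d (by simp [mem_closers, h, h3, h4])).symm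
    · rw [h]
    · have := hc (p d) (by simp [mem_closers, h, h1, h2, hp]); rwa [hp] at this
  have hm : 0 < m := by have := a.2; omega
  -- Unrolling the circle makes the interval that wraps around 0 an ordinary interval.
  let u : ℕ → ℚ := fun k => v ⟨k % m, Nat.mod_lt _ hm⟩
  have hu : ∀ d : Fin m, u d = v d := fun d => by
    simp only [u]; congr 1; ext; exact Nat.mod_eq_of_lt d.2
  have hu1 : ∀ d : Fin m, u (d + 1) = v (finRotate m d) := fun d => by
    simp only [u]; congr 1; ext
    simp only [val_finRotate]
    split_ifs with h
    · rw [h, Nat.mod_self]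
    · exact Nat.mod_eq_of_lt (by omega)
  have hper : ∀ k, u (k + m) = u k := fun k => by simp [u]
  have hpa : p (p a) = a := hp a
  have hpx : p (p x) = x := hp x
  have e1 := hv' a
  have e2 := hv' x
  have e3 := hv' (p a)
  have e4 := hv' (p x)
  rw [hp] at e3 e4
  rw [← hu1, ← hu] at e1 e2 e3 e4
  have hstep : ∀ k, k < m → k ≠ a → k ≠ x → k ≠ p a → k ≠ p x → u (k + 1) = u k := by
    intro k hk h1 h2 h3 h4
    have := hc' ⟨k, hk⟩ (by rintro rfl; exact h1 rfl) (by rintro rfl; exact h2 rfl)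
      (fun h => h3 (congrArg Fin.val h)) (fun h => h4 (congrArg Fin.val h))
    rwa [← hu1, ← hu] at this
  rw [Fin.lt_def] at hax hxb hby
  have i1 : ∀ k, (a : ℕ) + 1 ≤ k → k ≤ x → u k = u (a + 1) := fun k =>
    eq_of_forall_succ fun k h1 h2 =>
      hstep k (by omega) (by omega) (by omega) (by omega) (by omega)
  have i2 : ∀ k, (x : ℕ) + 1 ≤ k → k ≤ p a → u k = u (x + 1) := fun k =>
    eq_of_forall_succ fun k h1 h2 =>
      hstep k (by omega) (by omega) (by omega) (by omega) (by omega)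
  have i3 : ∀ k, (p a : ℕ) + 1 ≤ k → k ≤ p x → u k = u (p a + 1) := fun k =>
    eq_of_forall_succ fun k h1 h2 =>
      hstep k (by omega) (by omega) (by omega) (by omega) (by omega)
  have i4 : ∀ k, (p x : ℕ) + 1 ≤ k → k ≤ m + a → u k = u (p x + 1) := fun k =>
    eq_of_forall_succ fun k h1 h2 => by
      rcases lt_or_ge k m with h | h
      · exact hstep k (by omega) (by omega) (by omega) (by omega) (by omega)
      · obtain ⟨j, rfl⟩ := Nat.exists_eq_add_of_le h
        have := hstep j (by omega) (by omega) (by omega) (by omega) (by omega)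
        rw [show m + j + 1 = j + 1 + m by ring, show m + j = j + m by ring, hper, hper, this]
  have j1 := i1 x (by omega) le_rfl
  have j2 := i2 (p a) (by omega) le_rfl
  have j3 := i3 (p x) (by omega) le_rfl
  have j4 := i4 (m + a) (by omega) le_rfl
  rw [show m + (a : ℕ) = a + m by ring, hper] at j4
  have hall : ∀ d : Fin m, v d = u a := by
    intro d
    rw [← hu]
    have hd := d.2
    rcases le_or_gt (d : ℕ) a with h | h
    · have := i4 (m + d) (by omega) (by omega)
      rw [show m + (d : ℕ) = d + m by ring, hper] at this
      rw [this, j4]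
    · rcases le_or_gt (d : ℕ) x with h | h
      · rw [i1 d (by omega) (by omega)]; linarith
      · rcases le_or_gt (d : ℕ) (p a) with h | h
        · rw [i2 d (by omega) (by omega)]; linarith
        · rcases le_or_gt (d : ℕ) (p x) with h | h
          · rw [i3 d (by omega) (by omega)]; linarith
          · rw [i4 d (by omega) (by omega)]; linarith
  intro d d'
  rw [hall, hall]

theorem noncrossing_of_le_numCycles (hp : ∀ d, p (p d) = d)
    (h : (closers p).card + 1 ≤ numCycles (finRotate m * p)) : Noncrossing p := by
  intro i j hij hj
  by_contra hcon
  have h1 : p j ≠ i := fun h => by rw [← h, hp] at hj; exact lt_irrefl _ hj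
  have h2 : p j ≠ p i := fun h => hij.ne' (p.injective h)
  rcases lt_or_gt_of_ne h1 with h3 | h3
  · have := numCycles_lt_of_crossing hp h3 (by rwa [hp]) (by rwa [hp])
    omega
  · rcases lt_or_gt_of_ne h2 with h4 | h4
    · exact hcon ⟨h3, h4⟩
    · have := numCycles_lt_of_crossing hp hij hj h4
      omega

/-- The interval spanned by an arc of a noncrossing involution is a union of cycles. -/
theorem Noncrossing.interval_invariant (hp : ∀ d, p (p d) = d) (hnc : Noncrossing p) {b : Fin m}
    (hb : p b < b) (d : Fin m) :
    (p b < finRotate m (p d) ∧ finRotate m (p d) ≤ b) ↔ (p b < d ∧ d ≤ b) := by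
  have h1 : p b < d → d < b → p b < p d ∧ p d < b := fun h h' => by
    have := hnc (p b) d h (by rwa [hp])
    rwa [hp] at this
  have h2 : p b < p d → p d < b → p b < d ∧ d < b := fun h h' => by
    have := hnc (p b) (p d) h (by rwa [hp])
    rwa [hp, hp] at this
  have h3 : p d = p b → d = b := fun h => p.injective h
  have h4 : p d = b → d = p b := fun h => by rw [← h, hp]
  have h5 : d = b → p d = p b := fun h => by rw [h]
  have h6 : d = p b → p d = b := fun h => by rw [h, hp]
  have := (p d).2
  have := b.2
  simp only [Fin.lt_def, Fin.le_def, Fin.ext_iff, val_finRotate] at *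
  split_ifs <;> omega

/-- The closers and 0 lie in distinct cycles: each `(p b, b]` is a union of cycles, contains no
closer beyond `b`, and misses 0. In `F`, `none` stands for 0. -/
theorem Noncrossing.card_closers_lt (hp : ∀ d, p (p d) = d) (hnc : Noncrossing p) (hm : 0 < m) :
    (closers p).card + 1 ≤ numCycles (finRotate m * p) := by
  let Q := Quotient (Equiv.Perm.SameCycle.setoid (finRotate m * p))
  let F : Option (closers p) → Q := fun o => Quotient.mk _ (o.elim ⟨0, hm⟩ Subtype.val)
  have hinv : ∀ b, p b < b → ∀ d d', (finRotate m * p).SameCycle d d' →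
      p b < d → d ≤ b → (p b < d' ∧ d' ≤ b) := by
    intro b hb d d' h h1 h2
    obtain ⟨i, rfl⟩ := h.exists_nat_pow_eq
    clear h
    induction i with
    | zero => exact ⟨h1, h2⟩
    | succ i ih =>
      rw [pow_succ']
      exact (hnc.interval_invariant hp hb _).2 ih
  have hlt : ∀ b b' : closers p, F (some b) = F (some b') → b'.1 ≤ b.1 := fun b b' h =>
    (hinv b.1 (mem_closers.1 b.2) b.1 b'.1 (Quotient.exact h) (mem_closers.1 b.2) le_rfl).2
  have hne : ∀ b : closers p, F (some b) ≠ F none := fun b h => by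
    have := (hinv b.1 (mem_closers.1 b.2) b.1 ⟨0, hm⟩ (Quotient.exact h)
      (mem_closers.1 b.2) le_rfl).1
    simp [Fin.lt_def] at this
  have hF : Function.Injective F := by
    rintro (_ | b) (_ | b') h
    · rfl
    · exact absurd h.symm (hne b')
    · exact absurd h (hne b)
    · exact congrArg some (Subtype.ext (le_antisymm (hlt b' b h.symm) (hlt b b' h)))
  have := Nat.card_le_card_of_injective F hF
  rw [Finite.card_option, Nat.card_eq_fintype_card, Fintype.card_coe] at this
  exact this

theorem Noncrossing.numCycles_eq (hp : ∀ d, p (p d) = d) (hnc : Noncrossing p) (hm : 0 < m) :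
    numCycles (finRotate m * p) = (closers p).card + 1 :=
  le_antisymm (numCycles_finRotate_mul_le hp) (hnc.card_closers_lt hp hm)

/-- A noncrossing involution is determined by its openers and its closers. -/
theorem Noncrossing.ext (hp : ∀ d, p (p d) = d) (hq : ∀ d, q (q d) = d) (hnp : Noncrossing p)
    (hnq : Noncrossing q) (h1 : ∀ d, p d < d ↔ q d < d) (h2 : ∀ d, d < p d ↔ d < q d) : p = q := by
  -- Strong induction on the closer. If `p b < q b`, the opener `q b` is nested under the `p`-arc of
  -- `b`, so its `p`-partner is an earlier closer, where `p` and `q` agree; this forces the partner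
  -- to be `b`. The other case is symmetric.
  have key : ∀ b : Fin m, p b < b → p b = q b := by
    intro b
    induction b using WellFoundedLT.induction with | _ b ih =>
    intro hb
    by_contra hne
    rcases lt_or_gt_of_ne hne with h | h
    · have hqb := (h1 b).1 hb
      have ho : q b < p (q b) := (h2 _).2 (by rwa [hq])
      have := hnp (p b) (q b) h (by rwa [hp])
      rw [hp] at this
      have e := ih (p (q b)) this.2 (by rwa [hp])
      rw [hp] at e
      have : p (q b) = b := by
        conv_lhs => rw [← hq (p (q b)), ← e, hq]
      exact absurd this (ne_of_lt (by tauto))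
    · have hqb := (h1 b).1 hb
      have ho : p b < q (p b) := (h2 _).1 (by rwa [hp])
      have := hnq (q b) (p b) h (by rwa [hq])
      rw [hq] at this
      have e := ih (q (p b)) this.2 ((h1 _).2 (by rwa [hq]))
      rw [hq] at e
      have : q (p b) = b := by
        conv_lhs => rw [← hp (q (p b)), e, hp]
      exact absurd this (ne_of_lt (by tauto))
  ext d
  rcases lt_trichotomy (p d) d with h | h | h
  · rw [key d h]
  · have a1 := h1 d
    have a2 := h2 d
    rw [h] at a1 a2
    simp only [lt_self_iff_false, false_iff, not_lt] at a1 a2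
    rw [h]; exact congrArg Fin.val (le_antisymm a1 a2)
  · have e := key (p d) (by rwa [hp])
    rw [hp] at e
    rw [← hq (p d), ← e]

end Fin

/-! ### Pairs of noncrossing involutions versus planar maps with a spanning tree. -/

section Code

variable {m : ℕ} {p q : Equiv.Perm (Fin m)}

/-- Two noncrossing involutions such that each element is moved by exactly one of them. -/
structure IsCode (p q : Equiv.Perm (Fin m)) : Prop where
  invol_left : ∀ d, p (p d) = d
  invol_right : ∀ d, q (q d) = d
  noncrossing_left : Noncrossing p
  noncrossing_right : Noncrossing q
  ne_iff : ∀ d, p d ≠ d ↔ q d = d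

theorem IsCode.right_left_ne (h : IsCode p q) (d : Fin m) : q (p d) ≠ d := by
  by_cases hd : p d = d
  · rw [hd]; exact fun h' => (h.ne_iff d).2 h' hd
  · have : q (p d) = p d := (h.ne_iff _).1 (by rw [h.invol_left]; exact Ne.symm hd)
    rwa [this]

theorem IsCode.right_left_comm (h : IsCode p q) (d : Fin m) : q (p d) = p (q d) := by
  by_cases hd : p d = d
  · have h1 : q d ≠ d := fun h' => (h.ne_iff d).2 h' hd
    have h2 : p (q d) = q d := by
      by_contra h2
      have := (h.ne_iff _).1 h2
      rw [h.invol_right] at this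
      exact h1 this.symm
    rw [hd, h2]
  · have : q (p d) = p d := (h.ne_iff _).1 (by rw [h.invol_left]; exact Ne.symm hd)
    rw [this, (h.ne_iff d).1 hd]

theorem card_closers_add (h1 : ∀ d, p (p d) = d) (h2 : ∀ d, q (q d) = d)
    (h : ∀ d, p d ≠ d ↔ q d = d) : 2 * (closers p).card + 2 * (closers q).card = m := by
  rw [two_mul_card_closers h1, two_mul_card_closers h2]
  have : (Finset.univ.filter fun d => q d ≠ d) = Finset.univ.filter fun d => ¬ p d ≠ d := by
    ext d; simpa using (not_congr (h d)).symm
  rw [this, Finset.card_filter_add_card_filter_not]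
  simp

/-- The iterates `r, τ r, τ² r, …` up to the minimal period enumerate the only cycle, so the period
is `m`. -/
theorem exists_labelling (τ : Equiv.Perm (Fin m)) (hτ : ∀ r d, τ.SameCycle r d) (r : Fin m) :
    ∃ f : Equiv.Perm (Fin m), f ⟨0, by have := r.2; omega⟩ = r ∧
      ∀ d, f (finRotate m d) = τ (f d) := by
  set P := Function.minimalPeriod τ r with hP
  have hper : r ∈ Function.periodicPts τ := by
    refine Function.mem_periodicPts.2 ⟨orderOf τ, orderOf_pos τ, ?_⟩
    rw [Function.IsPeriodicPt, Function.IsFixedPt, ← Equiv.Perm.coe_pow, pow_orderOf_eq_one]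
    rfl
  have hpos : 0 < P := Function.minimalPeriod_pos_of_mem_periodicPts hper
  have hbij : Function.Bijective (fun i : Fin P => τ^[i] r) := by
    constructor
    · intro i j hij
      exact Fin.ext (Function.iterate_injOn_Iio_minimalPeriod i.2 j.2 hij)
    · intro d
      obtain ⟨k, hk⟩ := (hτ r d).exists_nat_pow_eq
      refine ⟨⟨k % P, Nat.mod_lt _ hpos⟩, ?_⟩
      simp only
      rw [hP, Function.iterate_mod_minimalPeriod_eq, ← hk, Equiv.Perm.coe_pow]
  have hcard : P = m := by simpa using Fintype.card_of_bijective hbij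
  clear_value P
  subst hcard
  refine ⟨Equiv.ofBijective _ hbij, rfl, fun d => ?_⟩
  simp only [Equiv.ofBijective_apply, val_finRotate]
  rw [← Function.iterate_succ_apply' τ]
  split_ifs with h
  · rw [Nat.succ_eq_add_one, h]
    have hm : τ^[P] r = r := by
      have := Function.iterate_minimalPeriod (f := τ) (x := r)
      rwa [← hP] at this
    exact hm.symm
  · rfl

/-- The labelling `f` of the darts of `M` identifies the contour of `T` with the rotation, and the
reversal of the darts in `T` and outside of `T` with `p` and `q`. -/
structure Realizes (M : CombMap (Fin m)) (T : Set M.Edge) (f p q : Equiv.Perm (Fin m)) :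
    Prop where
  contour : ∀ d, f (finRotate m d) = M.contour T (f d)
  left : ∀ d, f (p d) = M.revOn T (f d)
  right : ∀ d, f (q d) = M.revOn Tᶜ (f d)

namespace Realizes

variable {M : CombMap (Fin m)} {T : Set M.Edge} {f : Equiv.Perm (Fin m)}

theorem next (h : Realizes M T f p q) (d : Fin m) : f (finRotate m (p d)) = M.next (f d) := by
  rw [h.contour, h.left, CombMap.contour_revOn]

theorem next_rev (h : Realizes M T f p q) (d : Fin m) :
    f (finRotate m (q d)) = M.next (M.rev (f d)) := by
  rw [h.contour, h.right, CombMap.contour_revOn_compl]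

theorem rev (h : Realizes M T f p q) (d : Fin m) : f (q (p d)) = M.rev (f d) := by
  rw [h.right, h.left, CombMap.revOn_compl_revOn]

theorem card_vertex (h : Realizes M T f p q) :
    Nat.card M.Vertex = numCycles (finRotate m * p) :=
  (numCycles_congr f h.next).symm

theorem card_face (h : Realizes M T f p q) :
    Nat.card M.Face = numCycles (finRotate m * q) :=
  (numCycles_congr f h.next_rev).symm

theorem edge_mem (h : Realizes M T f p q) (d : Fin m) : M.edge (f d) ∈ T ↔ p d ≠ d := by
  rw [← CombMap.revOn_ne_iff, ← h.left, f.injective.ne_iff]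

/-- The darts labelled `finRotate m d` and `p d` share their source, and those labelled `d` and `p
d` are equal or joined by an edge of `T`. Thus consecutive labels are connected. -/
theorem connectedBy (h : Realizes M T f p q) (hp : ∀ d, p (p d) = d) : M.ConnectedBy T := by
  have step : ∀ d, Relation.ReflTransGen
      (fun a b => ∃ d, M.edge d ∈ T ∧ M.source d = a ∧ M.target d = b)
      (M.source (f d)) (M.source (f (p d))) := by
    intro d
    by_cases hd : p d = d
    · rw [hd]
    · have hT := (h.edge_mem d).2 hd
      refine .single ⟨f d, hT, rfl, ?_⟩
      rw [h.left, CombMap.revOn_of_mem hT]; rfl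
  have hrot : ∀ d, M.source (f (finRotate m d)) = M.source (f (p d)) := by
    intro d
    have := h.next (p d)
    rw [hp] at this
    rw [this, CombMap.source_next]
  have key : ∀ (a k : ℕ) (h1 : a < m) (h2 : a + k < m), Relation.ReflTransGen
      (fun a b => ∃ d, M.edge d ∈ T ∧ M.source d = a ∧ M.target d = b)
      (M.source (f ⟨a, h1⟩)) (M.source (f ⟨a + k, h2⟩)) := by
    intro a k h1
    induction k with
    | zero => intro _; exact .refl
    | succ k ih =>
      intro h2
      have h3 : a + k < m := by omega
      have e : (⟨a + (k + 1), h2⟩ : Fin m) = finRotate m ⟨a + k, h3⟩ := by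
        ext; rw [val_finRotate]; simp only; rw [if_neg (by omega)]; rfl
      rw [e, hrot]
      exact (ih h3).trans (step _)
  have symm : ∀ {a b}, Relation.ReflTransGen
      (fun a b => ∃ d, M.edge d ∈ T ∧ M.source d = a ∧ M.target d = b) a b →
      Relation.ReflTransGen
      (fun a b => ∃ d, M.edge d ∈ T ∧ M.source d = a ∧ M.target d = b) b a := by
    intro a b hab
    induction hab with
    | refl => exact .refl
    | tail _ hbc ih =>
      obtain ⟨d, hd, h1, h2⟩ := hbc
      exact .head ⟨M.rev d, by rwa [CombMap.edge_rev], h2, by rw [CombMap.target, M.rev_rev, h1]⟩ ih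
  intro u v
  induction u using Quotient.inductionOn with | _ d =>
  induction v using Quotient.inductionOn with | _ d' =>
  change Relation.ReflTransGen _ (M.source d) (M.source d')
  obtain ⟨d, rfl⟩ := f.surjective d
  obtain ⟨d', rfl⟩ := f.surjective d'
  rcases le_total (d : ℕ) d' with hle | hle
  · obtain ⟨k, hk⟩ := Nat.exists_eq_add_of_le hle
    have := key d k d.2 (by omega)
    convert this using 3
    exact Fin.ext hk
  · obtain ⟨k, hk⟩ := Nat.exists_eq_add_of_le hle
    refine symm ?_
    have := key d' k d'.2 (by omega)
    convert this using 3
    exact Fin.ext hk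

/-- The interval `(p b, b]` under the arc of the first edge of a cycle is a union of vertices, and
by noncrossing that edge is the only one of `T` that leaves it. A cycle would cross this cut exactly
once. -/
theorem not_hasCycle (h : Realizes M T f p q) (hp : ∀ d, p (p d) = d) (hnc : Noncrossing p) :
    ¬ M.HasCycle T := by
  rintro ⟨k, c, hT, htgt, -, hinj⟩
  obtain ⟨b, hb, hb0⟩ : ∃ b, p b < b ∧ (c 0 = f b ∨ c 0 = f (p b)) := by
    obtain ⟨d, hd⟩ := f.surjective (c 0)
    have : p d ≠ d := by rw [← h.edge_mem, hd]; exact hT 0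
    rcases lt_or_gt_of_ne this with h1 | h1
    · exact ⟨d, h1, Or.inl hd.symm⟩
    · exact ⟨p d, by rwa [hp], Or.inr (by rw [hp, hd])⟩
  have hTb : M.edge (f b) ∈ T := (h.edge_mem b).2 hb.ne
  have hedge0 : M.edge (c 0) = M.edge (f b) := by
    rcases hb0 with e | e
    · rw [e]
    · rw [e, h.left, CombMap.edge_revOn]
  let A : Fin m → Prop := fun d => p b < f.symm d ∧ f.symm d ≤ b
  have hnext : ∀ d, A d → A (M.next d) := by
    intro d hd
    have e : f.symm (M.next d) = finRotate m (p (f.symm d)) := by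
      rw [Equiv.symm_apply_eq, h.next, Equiv.apply_symm_apply]
    simp only [A, e]
    exact (hnc.interval_invariant hp hb _).2 hd
  have hsrc : ∀ d d', M.source d = M.source d' → (A d ↔ A d') := fun d d' hd =>
    ⟨CombMap.forall_source_eq hnext hd, CombMap.forall_source_eq hnext hd.symm⟩
  have hrev : ∀ d, M.edge d ∈ T → M.edge d ≠ M.edge (f b) → (A (M.rev d) ↔ A d) := by
    intro d hd hne
    obtain ⟨x, rfl⟩ := f.surjective d
    rw [← CombMap.revOn_of_mem hd, ← h.left]
    simp only [A, Equiv.symm_apply_apply]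
    have hx1 : x ≠ b := by rintro rfl; exact hne rfl
    have hx2 : x ≠ p b := by
      rintro rfl; exact hne (by rw [h.left, CombMap.edge_revOn])
    have hx3 : p x ≠ p b := p.injective.ne hx1
    have hx4 : p x ≠ b := fun e => hx2 (by rw [← e, hp])
    have h1 : p b < x → x < b → p b < p x ∧ p x < b := fun h h' => by
      have := hnc (p b) x h (by rwa [hp])
      rwa [hp] at this
    have h2 : p b < p x → p x < b → p b < x ∧ x < b := fun h h' => by
      have := hnc (p b) (p x) h (by rwa [hp])
      rwa [hp, hp] at this
    constructor
    · rintro ⟨a1, a2⟩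
      have := h2 a1 (lt_of_le_of_ne a2 hx4)
      exact ⟨this.1, this.2.le⟩
    · rintro ⟨a1, a2⟩
      have := h1 a1 (lt_of_le_of_ne a2 hx1)
      exact ⟨this.1, this.2.le⟩
  have h0 : A (M.rev (c 0)) ↔ ¬ A (c 0) := by
    have e1 : M.rev (f b) = f (p b) := by rw [← CombMap.revOn_of_mem hTb, h.left]
    have e2 : M.rev (f (p b)) = f b := by rw [← e1, M.rev_rev]
    rcases hb0 with e | e
    · rw [e, e1]; simp [A, hb]
    · rw [e, e2]; simp [A, hb]
  have hstep : ∀ i, A (M.rev (c i)) ↔ A (c (i + 1)) := fun i => hsrc _ _ (htgt i)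
  have hconst : ∀ j (hj : j < k + 1), 0 < j → (A (c ⟨j, hj⟩) ↔ A (M.rev (c 0))) := by
    intro j hj h0j
    induction j, h0j using Nat.le_induction with
    | base =>
      rw [hstep 0]
      have : (⟨Nat.succ 0, hj⟩ : Fin (k + 1)) = 0 + 1 := by
        ext; rw [Fin.val_add_one_of_lt (by rw [Fin.lt_def]; simp; omega)]; simp
      rw [← this]
    | succ j hj1 ih =>
      have e : (⟨j + 1, hj⟩ : Fin (k + 1)) = ⟨j, by omega⟩ + 1 := by
        ext; rw [Fin.val_add_one_of_lt (by rw [Fin.lt_def]; simp; omega)]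
      rw [e, ← hstep, hrev _ (hT _), ih]
      rw [← hedge0]
      intro hcon
      have := hinj hcon
      simp [Fin.ext_iff] at this
      omega
  have hfin : A (M.rev (c (Fin.last k))) ↔ A (c 0) := by rw [hstep, Fin.last_add_one]
  rcases Nat.eq_zero_or_pos k with rfl | hk
  · have : Fin.last 0 = 0 := rfl
    rw [this] at hfin
    exact iff_not_self (hfin.symm.trans h0)
  · have h1 := hconst k (by omega) hk
    have h2 : A (M.rev (c (Fin.last k))) ↔ A (c (Fin.last k)) := by
      refine hrev _ (hT _) ?_
      rw [← hedge0]
      intro hcon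
      have := hinj hcon
      simp [Fin.ext_iff] at this
      omega
    have e : (⟨k, by omega⟩ : Fin (k + 1)) = Fin.last k := rfl
    rw [e] at h1
    exact iff_not_self (hfin.symm.trans (h2.trans (h1.trans h0)))

theorem isSpanningTree (h : Realizes M T f p q) (hp : ∀ d, p (p d) = d) (hnc : Noncrossing p) :
    M.IsSpanningTree T :=
  ⟨h.connectedBy hp, h.not_hasCycle hp hnc⟩

end Realizes

theorem CombMap.two_mul_card_edge (M : CombMap (Fin m)) : 2 * Nat.card M.Edge = m := by
  have : Nat.card M.Edge = (closers M.rev).card := numCycles_involution M.rev_rev M.rev_ne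
  rw [this, two_mul_card_closers M.rev_rev]
  simp [M.rev_ne]

/-- The contour of a spanning tree encodes a planar map by a pair of noncrossing involutions. -/
theorem exists_realizes {M : CombMap (Fin m)} (hM : M.IsPlanar) {T : Set M.Edge}
    (hT : M.IsSpanningTree T) (r : Fin m) :
    ∃ f p q, f ⟨0, by have := r.2; omega⟩ = r ∧ Realizes M T f p q ∧ IsCode p q := by
  obtain ⟨f, hf0, hf⟩ := exists_labelling (M.contour T) hT.sameCycle_contour r
  have hR : Realizes M T f (f.trans ((M.revOn T).trans f.symm))
      (f.trans ((M.revOn Tᶜ).trans f.symm)) := ⟨hf, by simp, by simp⟩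
  refine ⟨f, _, _, hf0, hR, ?_⟩
  generalize f.trans ((M.revOn T).trans f.symm) = p at *
  generalize f.trans ((M.revOn Tᶜ).trans f.symm) = q at *
  have hp : ∀ d, p (p d) = d := fun d => f.injective (by
    rw [hR.left, hR.left, CombMap.revOn_revOn])
  have hq : ∀ d, q (q d) = d := fun d => f.injective (by
    rw [hR.right, hR.right, CombMap.revOn_revOn])
  have hpq : ∀ d, p d ≠ d ↔ q d = d := by
    intro d
    rw [← hR.edge_mem d, ← f.injective.eq_iff, hR.right, ← not_iff_not, ← ne_eq,
      CombMap.revOn_ne_iff]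
    rfl
  -- By Euler's formula the two upper bounds, for vertices and for faces, add up to the true total,
  -- so both are equalities and no arcs cross.
  have h1 := numCycles_finRotate_mul_le hp
  have h2 := numCycles_finRotate_mul_le hq
  have h3 := card_closers_add hp hq hpq
  have h4 := hM.2
  have h5 := M.two_mul_card_edge
  rw [hR.card_vertex, hR.card_face] at h4
  exact ⟨hp, hq, noncrossing_of_le_numCycles hp (by omega),
    noncrossing_of_le_numCycles hq (by omega), hpq⟩

/-- The planar map encoded by a pair of noncrossing involutions. -/
def IsCode.combMap (h : IsCode p q) : CombMap (Fin m) where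
  next := finRotate m * p
  rev := q * p
  rev_rev d := by
    simp only [Equiv.Perm.mul_apply]
    rw [← h.right_left_comm, h.invol_left, h.invol_right]
  rev_ne := h.right_left_ne

/-- The tree is read off from the code as the edges whose darts `p` moves. Allowing any isomorphic
`M` covers both `combMap` itself and the chosen representative of its class. -/
theorem IsCode.realizes_of_iso (h : IsCode p q) (M : CombMap (Fin m)) (f : Equiv.Perm (Fin m))
    (hn : ∀ d, f (finRotate m (p d)) = M.next (f d)) (hr : ∀ d, f (q (p d)) = M.rev (f d)) :
    Realizes M {e | ∃ d, M.edge (f d) = e ∧ p d ≠ d} f p q := by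
  set T : Set M.Edge := {e | ∃ d, M.edge (f d) = e ∧ p d ≠ d} with hT
  have hmem : ∀ d, M.edge (f d) ∈ T ↔ p d ≠ d := by
    intro d
    constructor
    · rintro ⟨d', h1, h2⟩
      rcases M.edge_eq_iff.1 h1 with h3 | h3
      · rwa [f.injective h3]
      · rw [← hr] at h3
        rw [f.injective h3, h.right_left_comm, (h.ne_iff d').1 h2, h.invol_left]
        exact h2.symm
    · exact fun hd => ⟨d, rfl, hd⟩
  have hl : ∀ d, f (p d) = M.revOn T (f d) := by
    intro d
    by_cases hd : p d = d
    · rw [CombMap.revOn_of_notMem (by rw [hmem]; simpa using hd), hd]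
    · rw [CombMap.revOn_of_mem ((hmem d).2 hd), ← hr, h.right_left_comm, (h.ne_iff d).1 hd]
  refine ⟨fun d => ?_, hl, fun d => ?_⟩
  · have := hn (p d)
    rw [h.invol_left] at this
    rw [this, hl]; rfl
  · by_cases hd : p d = d
    · rw [CombMap.revOn_of_mem (by rw [Set.mem_compl_iff, hmem]; simpa using hd), ← hr, hd]
    · rw [CombMap.revOn_of_notMem (by rw [Set.mem_compl_iff, hmem]; simpa using hd),
        (h.ne_iff d).1 hd]

theorem IsCode.isPlanar_combMap (h : IsCode p q) (hm : 0 < m) : h.combMap.IsPlanar := by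
  have hR := h.realizes_of_iso h.combMap 1 (fun _ => rfl) (fun _ => rfl)
  refine ⟨(hR.connectedBy h.invol_left).mono (Set.subset_univ _), ?_⟩
  rw [hR.card_vertex, hR.card_face, h.noncrossing_left.numCycles_eq h.invol_left hm,
    h.noncrossing_right.numCycles_eq h.invol_right hm]
  have := h.combMap.two_mul_card_edge
  have := card_closers_add h.invol_left h.invol_right h.ne_iff
  omega

end Code

/-! ### Injective encoding of tree-rooted maps by two subsets. -/

section TreeRooted

variable {n : ℕ} {p q : Equiv.Perm (Fin (2 * n))}

/-- The pair `(p, q)` encodes the tree-rooted map `x`. -/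
def TreeRootedMap.Encodes (x : TreeRootedMap n) (p q : Equiv.Perm (Fin (2 * n))) : Prop :=
  ∃ f : Equiv.Perm (Fin (2 * n)), (∀ d, d.val = 0 → f d = x.1.rep.root) ∧
    Realizes x.1.rep.toCombMap x.2.1 f p q

theorem TreeRootedMap.exists_encodes (x : TreeRootedMap n) :
    ∃ p q, x.Encodes p q ∧ IsCode p q := by
  obtain ⟨f, p, q, h0, hR, hc⟩ := exists_realizes x.1.rep.planar x.2.2 x.1.rep.root
  exact ⟨p, q, ⟨f, fun d hd => by rw [← h0]; congr 1; exact Fin.ext hd, hR⟩, hc⟩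

theorem TreeRootedMap.eq_of_encodes {x y : TreeRootedMap n} (hx : x.Encodes p q)
    (hy : y.Encodes p q) : x = y := by
  obtain ⟨M, T, hT⟩ := x
  obtain ⟨N, S, hS⟩ := y
  obtain ⟨f, hf0, hf⟩ := hx
  obtain ⟨g, hg0, hg⟩ := hy
  simp only at hf0 hf hg0 hg
  have hpos : 0 < 2 * n := by have := M.rep.root.2; omega
  have key : M = N := by
    have : M.rep ≈ N.rep := by
      refine ⟨f.symm.trans g, fun d => ?_, fun d => ?_, ?_⟩
      · obtain ⟨d, rfl⟩ := f.surjective d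
        simp [← hf.next, ← hg.next]
      · obtain ⟨d, rfl⟩ := f.surjective d
        simp [← hf.rev, ← hg.rev]
      · rw [← hf0 ⟨0, hpos⟩ rfl, ← hg0 ⟨0, hpos⟩ rfl]; simp
    exact Quotient.out_equiv_out.1 this
  subst key
  -- A rooted connected map has no nontrivial automorphism, so the labellings, and then the trees,
  -- coincide.
  have hfg : f = g := by
    have : ∀ d, g (f.symm d) = d := by
      refine M.rep.planar.1.induction (P := fun d => g (f.symm d) = d) (r := M.rep.root) ?_ ?_ ?_
      · rw [← hf0 ⟨0, hpos⟩ rfl, Equiv.symm_apply_apply, hf0 _ rfl, hg0 _ rfl]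
      · intro d hd
        obtain ⟨d, rfl⟩ := f.surjective d
        rw [Equiv.symm_apply_apply] at hd
        rw [← hf.next, Equiv.symm_apply_apply, hg.next, hf.next, hd]
      · intro d _ hd
        obtain ⟨d, rfl⟩ := f.surjective d
        rw [Equiv.symm_apply_apply] at hd
        rw [← hf.rev, Equiv.symm_apply_apply, hg.rev, hf.rev, hd]
    ext d
    rw [← this (f d), Equiv.symm_apply_apply]
  subst hfg
  have hTS : T = S := by
    ext e
    induction e using Quotient.inductionOn with | _ d =>
    obtain ⟨d, rfl⟩ := f.surjective d
    exact (hf.edge_mem d).trans (hg.edge_mem d).symm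
  subst hTS
  rfl

theorem TreeRootedMap.exists_of_isCode (hn : 0 < n) (h : IsCode p q) :
    ∃ x : TreeRootedMap n, x.Encodes p q := by
  let L : LabelledRootedMap n := ⟨h.combMap, h.isPlanar_combMap (by omega), ⟨0, by omega⟩⟩
  let M : RootedPlanarMap n := Quotient.mk _ L
  obtain ⟨f, hf1, hf2, hf3⟩ : L ≈ M.rep := Setoid.symm (Quotient.mk_out L)
  have hR := h.realizes_of_iso M.rep.toCombMap f hf1 hf2
  refine ⟨⟨M, _, hR.isSpanningTree h.invol_left h.noncrossing_left⟩, f, fun d hd => ?_, hR⟩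
  rw [← hf3]
  congr 1
  exact Fin.ext hd

/-- The labelling is forced: it starts at the root and follows the contour. -/
theorem TreeRootedMap.code_unique {p' q' : Equiv.Perm (Fin (2 * n))} {x : TreeRootedMap n}
    (h : x.Encodes p q) (h' : x.Encodes p' q') : p = p' ∧ q = q' := by
  obtain ⟨f, hf0, hf⟩ := h
  obtain ⟨g, hg0, hg⟩ := h'
  have hfg : f = g := by
    have : ∀ (k : ℕ) (hk : k < 2 * n), f ⟨k, hk⟩ = g ⟨k, hk⟩ := by
      intro k
      induction k with
      | zero => intro hk; rw [hf0 _ rfl, hg0 _ rfl]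
      | succ k ih =>
        intro hk
        have e : (⟨k + 1, hk⟩ : Fin (2 * n)) = finRotate _ ⟨k, by omega⟩ := by
          ext; rw [val_finRotate]; simp only; rw [if_neg (by omega)]
        rw [e, hf.contour, hg.contour, ih]
    ext d
    rw [this d d.2]
  subst hfg
  exact ⟨Equiv.ext fun d => f.injective (by rw [hf.left, hg.left]),
    Equiv.ext fun d => f.injective (by rw [hf.right, hg.right])⟩

theorem TreeRootedMap.Encodes.numVertices {x : TreeRootedMap n} (h : x.Encodes p q)
    (hc : IsCode p q) : x.1.numVertices = (closers p).card + 1 := by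
  obtain ⟨f, -, hf⟩ := h
  have := x.1.rep.root.2
  rw [RootedPlanarMap.numVertices, hf.card_vertex,
    hc.noncrossing_left.numCycles_eq hc.invol_left (by omega)]

theorem RootedPlanarMap.numEdges_eq (M : RootedPlanarMap n) : M.numEdges = n := by
  have := M.rep.toCombMap.two_mul_card_edge
  rw [numEdges]
  omega

/-- The elements moved by `p`, and the smaller ends of the arcs of `p` and `q`. -/
def word (c : Equiv.Perm (Fin (2 * n)) × Equiv.Perm (Fin (2 * n))) :
    Finset (Fin (2 * n)) × Finset (Fin (2 * n)) :=
  (Finset.univ.filter fun d => c.1 d ≠ d, Finset.univ.filter fun d => d < c.1 d ∨ d < c.2 d)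

/-- Intersecting the opener set and its complement with the support and its complement recovers the
openers and closers of `p` and of `q`. -/
theorem IsCode.eq_of_word_eq {p' q' : Equiv.Perm (Fin (2 * n))} (h : IsCode p q)
    (h' : IsCode p' q') (hw : word (p, q) = word (p', q')) : (p, q) = (p', q') := by
  simp only [word, Prod.mk.injEq, Finset.ext_iff, Finset.mem_filter, Finset.mem_univ,
    true_and] at hw
  obtain ⟨hT, hO⟩ := hw
  have h1 := h.ne_iff
  have h2 := h'.ne_iff
  refine Prod.ext ?_ ?_
  · refine h.noncrossing_left.ext h.invol_left h'.invol_left h'.noncrossing_left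
      (fun d => ?_) (fun d => ?_)
    all_goals
      have a1 := hT d
      have a2 := hO d
      have a3 := h1 d
      have a4 := h2 d
      simp only [Fin.lt_def, ne_eq, Fin.ext_iff] at *
      omega
  · refine h.noncrossing_right.ext h.invol_right h'.invol_right h'.noncrossing_right
      (fun d => ?_) (fun d => ?_)
    all_goals
      have a1 := hT d
      have a2 := hO d
      have a3 := h1 d
      have a4 := h2 d
      simp only [Fin.lt_def, ne_eq, Fin.ext_iff] at *
      omega

/-- Tree-rooted maps are in bijection with the words of codes. -/
theorem exists_encoding (n : ℕ) :
    ∃ Φ : TreeRootedMap n → Finset (Fin (2 * n)) × Finset (Fin (2 * n)),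
      Function.Injective Φ ∧ (∀ x, 2 * x.1.numVertices = (Φ x).1.card + 2) ∧
      (0 < n → ∀ p q, IsCode p q → word (p, q) ∈ Set.range Φ) := by
  choose p q he hc using TreeRootedMap.exists_encodes (n := n)
  refine ⟨fun x => word (p x, q x), fun x y hxy => ?_, fun x => ?_, fun hn p' q' h => ?_⟩
  · have := (hc x).eq_of_word_eq (hc y) hxy
    rw [Prod.mk.injEq] at this
    have hx := he x
    rw [this.1, this.2] at hx
    exact TreeRootedMap.eq_of_encodes hx (he y)
  · rw [(he x).numVertices (hc x), mul_add, two_mul_card_closers (hc x).invol_left]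
    rfl
  · obtain ⟨x, hx⟩ := TreeRootedMap.exists_of_isCode hn h
    obtain ⟨h1, h2⟩ := TreeRootedMap.code_unique (he x) hx
    exact ⟨x, by simp only [h1, h2]⟩

end TreeRooted

/-! ### Ballot sequences, Dyck words and Catalan numbers. -/

section Ballot

variable {m : ℕ}

/-- A ballot sequence of openers and closers is the sequence of a noncrossing involution. -/
theorem exists_noncrossing (O C : Finset (Fin m)) (hd : Disjoint O C) (hcard : O.card = C.card)
    (hb : ∀ x, (C.filter (· ≤ x)).card ≤ (O.filter (· ≤ x)).card) :
    ∃ p : Equiv.Perm (Fin m), (∀ d, p (p d) = d) ∧ Noncrossing p ∧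
      (∀ d, d < p d ↔ d ∈ O) ∧ (∀ d, p d < d ↔ d ∈ C) := by
  induction hk : C.card generalizing O C with
  | zero =>
    rw [hk] at hcard
    rw [Finset.card_eq_zero] at hk hcard
    subst hk hcard
    refine ⟨1, by simp, fun i j h1 h2 => ?_, by simp, by simp⟩
    exact absurd (h1.trans h2) (lt_irrefl i)
  | succ k ih =>
    have hne : C.Nonempty := Finset.card_pos.1 (by omega)
    -- Match the first closer `b` with the last opener `a` before it: no opener or closer lies
    -- strictly between, so the arc can be added to the involution of the rest.
    set b := C.min' hne with hbdef
    have hbC : b ∈ C := C.min'_mem hne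
    have hbmin : ∀ d ∈ C, b ≤ d := fun d hd => C.min'_le d hd
    have hne' : (O.filter (· ≤ b)).Nonempty :=
      Finset.card_pos.1 (lt_of_lt_of_le
        (Finset.card_pos.2 (⟨b, Finset.mem_filter.2 ⟨hbC, le_rfl⟩⟩ : (C.filter (· ≤ b)).Nonempty))
        (hb b))
    set a := (O.filter (· ≤ b)).max' hne' with hadef
    have haO := Finset.mem_filter.1 ((O.filter (· ≤ b)).max'_mem hne')
    rw [← hadef] at haO
    obtain ⟨haO, hab⟩ := haO
    have hamax : ∀ d ∈ O, d ≤ b → d ≤ a := fun d hd hdb =>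
      Finset.le_max' _ d (Finset.mem_filter.2 ⟨hd, hdb⟩)
    clear_value a b
    have hab : a < b := lt_of_le_of_ne hab fun h =>
      Finset.disjoint_left.1 hd haO (h ▸ hbC)
    obtain ⟨p, hp, hnc, hpO, hpC⟩ := ih (O.erase a) (C.erase b)
      (Finset.disjoint_of_subset_left (Finset.erase_subset _ _)
        (Finset.disjoint_of_subset_right (Finset.erase_subset _ _) hd))
      (by rw [Finset.card_erase_of_mem haO, Finset.card_erase_of_mem hbC, hcard])
      (by
        intro x
        simp only [Finset.filter_erase]
        rcases le_or_gt b x with h | h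
        · rw [Finset.card_erase_of_mem (Finset.mem_filter.2 ⟨hbC, h⟩),
            Finset.card_erase_of_mem (Finset.mem_filter.2 ⟨haO, (hab.trans_le h).le⟩)]
          exact Nat.sub_le_sub_right (hb x) 1
        · have : C.filter (· ≤ x) = ∅ := by
            ext d
            simp only [Finset.mem_filter, Finset.notMem_empty, iff_false, not_and, not_le]
            exact fun hd => h.trans_le (hbmin d hd)
          rw [this]; simp)
      (by rw [Finset.card_erase_of_mem hbC, hk]; rfl)
    have hfix : ∀ d, d ∉ O.erase a → d ∉ C.erase b → p d = d := fun d h1 h2 =>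
      le_antisymm (not_lt.1 fun h => h1 ((hpO d).1 h)) (not_lt.1 fun h => h2 ((hpC d).1 h))
    have hpa : p a = a := hfix a (by simp) fun h =>
      Finset.disjoint_left.1 hd haO (Finset.mem_of_mem_erase h)
    have hpb : p b = b := hfix b
      (fun h => Finset.disjoint_left.1 hd (Finset.mem_of_mem_erase h) hbC) (by simp)
    have hra : (Equiv.swap a b * p) a = b := by simp [hpa]
    have hrb : (Equiv.swap a b * p) b = a := by simp [hpb]
    have hro : ∀ d, d ≠ a → d ≠ b → (Equiv.swap a b * p) d = p d := by
      intro d h1 h2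
      rw [Equiv.Perm.mul_apply]
      exact Equiv.swap_apply_of_ne_of_ne (fun h => h1 (p.injective (h.trans hpa.symm)))
        (fun h => h2 (p.injective (h.trans hpb.symm)))
    have hpna : ∀ d, d ≠ a → p d ≠ a := fun d h1 h => h1 (p.injective (h.trans hpa.symm))
    have hpnb : ∀ d, d ≠ b → p d ≠ b := fun d h1 h => h1 (p.injective (h.trans hpb.symm))
    generalize Equiv.swap a b * p = r at *
    refine ⟨r, fun d => ?_, fun i j hij hj => ?_, fun d => ?_, fun d => ?_⟩
    · by_cases h1 : d = a
      · rw [h1, hra, hrb]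
      · by_cases h2 : d = b
        · rw [h2, hrb, hra]
        · rw [hro d h1 h2, hro _ (hpna d h1) (hpnb d h2), hp]
    · by_cases h1 : i = a
      · rw [h1, hra] at hj ⊢
        rw [h1] at hij
        have : r j = j := by
          rw [hro j hij.ne' hj.ne]
          refine hfix j (fun h => ?_) (fun h => ?_)
          · exact absurd (hamax j (Finset.mem_of_mem_erase h) hj.le) (not_le.2 hij)
          · exact absurd (hbmin j (Finset.mem_of_mem_erase h)) (not_le.2 hj)
        rw [this]
        exact ⟨hij, hj⟩
      · by_cases h2 : i = b
        · rw [h2, hrb] at hj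
          rw [h2] at hij
          exact absurd (hij.trans hj) hab.not_gt
        · rw [hro i h1 h2] at hj ⊢
          have hiO : i ∈ O := Finset.mem_of_mem_erase ((hpO i).1 (hij.trans hj))
          have hiC : p i ∈ C :=
            Finset.mem_of_mem_erase ((hpC (p i)).1 (by rw [hp]; exact hij.trans hj))
          by_cases h3 : j = a
          · rw [h3, hra]
            rw [h3] at hij
            exact ⟨hij.trans hab, lt_of_le_of_ne (hbmin _ hiC) (hpnb i h2).symm⟩
          · by_cases h4 : j = b
            · rw [h4, hrb]
              rw [h4] at hij hj
              exact ⟨lt_of_le_of_ne (hamax i hiO hij.le) h1, hab.trans hj⟩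
            · rw [hro j h3 h4]
              exact hnc i j hij hj
    · by_cases h1 : d = a
      · rw [h1, hra]; exact iff_of_true hab haO
      · by_cases h2 : d = b
        · rw [h2, hrb]
          exact iff_of_false hab.not_gt fun h => Finset.disjoint_left.1 hd h hbC
        · rw [hro d h1 h2, hpO, Finset.mem_erase]
          exact and_iff_right h1
    · by_cases h1 : d = a
      · rw [h1, hra]
        exact iff_of_false hab.not_gt fun h => Finset.disjoint_left.1 hd haO h
      · by_cases h2 : d = b
        · rw [h2, hrb]
          exact iff_of_true hab hbC
        · rw [hro d h1 h2, hpC, Finset.mem_erase]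
          exact and_iff_right h2

theorem List.count_take_eq_card {α : Type*} [DecidableEq α] (l : List α) (s : α) (r : ℕ) :
    (l.take r).count s = ((Finset.range r).filter fun i => l[i]? = some s).card := by
  induction r with
  | zero => simp
  | succ r ih =>
    rw [List.take_add_one, List.count_append, ih, Finset.range_add_one, Finset.filter_insert]
    cases h : l[r]? with
    | none => simp
    | some x =>
      by_cases hx : x = s
      · simp [hx]
      · simp [hx]

/-- The positions of the letter `s` of a word whose letters are placed along `e`. -/
def positions {k : ℕ} (e : Fin k ↪o Fin m) (l : List DyckStep) (s : DyckStep) :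
    Finset (Fin m) :=
  (Finset.univ.filter fun i : Fin k => l[(i : ℕ)]? = some s).map e.toEmbedding

theorem mem_positions {k : ℕ} {e : Fin k ↪o Fin m} {l : List DyckStep} {s : DyckStep}
    (i : Fin k) : e i ∈ positions e l s ↔ l[(i : ℕ)]? = some s := by
  simp [positions]

/-- An initial segment of `Fin m` cuts out a prefix of the word. The same `r` serves both letters,
so the Dyck condition on prefixes becomes the ballot condition. -/
theorem exists_card_positions_le {k : ℕ} (e : Fin k ↪o Fin m) (l : List DyckStep) (x : Fin m) :
    ∃ r, ∀ s, ((positions e l s).filter (· ≤ x)).card = (l.take r).count s := by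
  obtain ⟨r, hrk, hr⟩ : ∃ r ≤ k, ∀ i : Fin k, e i ≤ x ↔ (i : ℕ) < r := by
    have hex : ∃ r, ∀ i : Fin k, r ≤ (i : ℕ) → x < e i := ⟨k, fun i hi => by omega⟩
    refine ⟨Nat.find hex, Nat.find_min' hex (fun i hi => by omega), fun i => ?_⟩
    constructor
    · intro h
      by_contra hcon
      exact absurd (Nat.find_spec hex i (not_lt.1 hcon)) (not_lt.2 h)
    · intro h
      have := Nat.find_min hex h
      push Not at this
      obtain ⟨i', h1, h2⟩ := this
      exact (e.monotone (Fin.le_def.2 h1)).trans h2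
  refine ⟨r, fun s => ?_⟩
  rw [List.count_take_eq_card]
  have h1 : (positions e l s).filter (· ≤ x) =
      (Finset.univ.filter fun i : Fin k => l[(i : ℕ)]? = some s ∧ (i : ℕ) < r).map
        e.toEmbedding := by
    ext d
    simp only [positions, Finset.mem_filter, Finset.mem_map, Finset.mem_univ, true_and]
    constructor
    · rintro ⟨⟨i, hi, rfl⟩, hx⟩
      exact ⟨i, ⟨hi, (hr i).1 hx⟩, rfl⟩
    · rintro ⟨i, ⟨hi, hir⟩, rfl⟩
      exact ⟨⟨i, hi, rfl⟩, (hr i).2 hir⟩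
  have h2 : ((Finset.range r).filter fun i => l[i]? = some s) =
      (Finset.univ.filter fun i : Fin k => l[(i : ℕ)]? = some s ∧ (i : ℕ) < r).map
        Fin.valEmbedding := by
    ext i
    simp only [Finset.mem_filter, Finset.mem_map, Finset.mem_univ, true_and, Finset.mem_range,
      Fin.valEmbedding_apply]
    constructor
    · rintro ⟨h1, h2⟩
      exact ⟨⟨i, by omega⟩, ⟨h2, h1⟩, rfl⟩
    · rintro ⟨i, ⟨h1, h2⟩, rfl⟩
      exact ⟨h2, h1⟩
  rw [h1, h2, Finset.card_map, Finset.card_map]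

open Classical in
/-- The possible sets of openers of noncrossing involutions with support `T`. -/
noncomputable def openerSets (T : Finset (Fin m)) : Finset (Finset (Fin m)) :=
  T.powerset.filter fun O => ∃ p : Equiv.Perm (Fin m), (∀ d, p (p d) = d) ∧ Noncrossing p ∧
    (∀ d, d < p d ↔ d ∈ O) ∧ (∀ d, p d < d ↔ d ∈ T \ O)

theorem positions_mem_openerSets {j : ℕ} {T : Finset (Fin m)} (hT : T.card = 2 * j)
    (w : DyckWord) (hw : w.semilength = j) :
    positions (T.orderEmbOfFin hT) w.toList DyckStep.U ∈ openerSets T := by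
  classical
  have hlen : w.toList.length = 2 * j := by rw [← hw, DyckWord.two_mul_semilength_eq_length]
  set e := T.orderEmbOfFin hT with he
  set l := w.toList with hl
  have hsub : ∀ s, positions e l s ⊆ T := by
    intro s d hd
    simp only [positions, Finset.mem_map] at hd
    obtain ⟨i, -, rfl⟩ := hd
    exact T.orderEmbOfFin_mem hT i
  have hsurj : ∀ d ∈ T, ∃ i, e i = d := by
    intro d hd
    have := T.range_orderEmbOfFin hT
    exact (Set.ext_iff.1 this d).2 hd
  have hD : T \ positions e l .U = positions e l .D := by
    ext d
    rw [Finset.mem_sdiff]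
    constructor
    · rintro ⟨hd, h⟩
      obtain ⟨i, rfl⟩ := hsurj d hd
      rw [mem_positions] at h ⊢
      have hi : (i : ℕ) < l.length := by omega
      rw [List.getElem?_eq_getElem hi] at h ⊢
      rcases DyckStep.dichotomy l[(i : ℕ)] with h' | h'
      · exact absurd (congrArg some h') h
      · exact congrArg some h'
    · intro hd
      refine ⟨hsub _ hd, ?_⟩
      obtain ⟨i, rfl⟩ := hsurj d (hsub _ hd)
      rw [mem_positions] at hd ⊢
      rw [hd]
      simp
  rw [openerSets, Finset.mem_filter, Finset.mem_powerset, hD]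
  refine ⟨hsub _, exists_noncrossing _ _ (hD ▸ Finset.disjoint_sdiff) ?_ fun x => ?_⟩
  · have hc : ∀ s, (positions e l s).card = l.count s := by
      intro s
      have := List.count_take_eq_card l s (2 * j)
      rw [List.take_of_length_le hlen.le] at this
      rw [this, positions, Finset.card_map]
      refine Finset.card_bij (fun i _ => i.val) ?_ ?_ ?_
      · intro i hi
        simp only [Finset.mem_filter, Finset.mem_univ, true_and, Finset.mem_range] at hi ⊢
        exact ⟨i.2, hi⟩
      · intro i _ i' _ h
        exact Fin.ext h
      · intro i hi
        simp only [Finset.mem_filter, Finset.mem_range] at hi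
        exact ⟨⟨i, hi.1⟩, by simpa using hi.2, rfl⟩
    rw [hc, hc, w.count_U_eq_count_D]
  · obtain ⟨r, hr⟩ := exists_card_positions_le e l x
    rw [hr, hr]
    exact w.count_D_le_count_U r

theorem catalan_le_card_openerSets {j : ℕ} {T : Finset (Fin m)} (hT : T.card = 2 * j) :
    catalan j ≤ (openerSets T).card := by
  rw [← DyckWord.card_dyckWord_semilength_eq_catalan, ← Fintype.card_coe (openerSets T)]
  refine Fintype.card_le_of_injective
    (fun w => ⟨_, positions_mem_openerSets hT w.1 w.2⟩) ?_
  rintro ⟨w, hw⟩ ⟨w', hw'⟩ h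
  have h := congrArg Subtype.val h
  simp only at h
  have hlen : w.toList.length = 2 * j := by rw [← hw, DyckWord.two_mul_semilength_eq_length]
  have hlen' : w'.toList.length = 2 * j := by rw [← hw', DyckWord.two_mul_semilength_eq_length]
  refine Subtype.ext (DyckWord.ext (List.ext_getElem (by rw [hlen, hlen']) fun i hi hi' => ?_))
  have hU := Finset.ext_iff.1 h (T.orderEmbOfFin hT ⟨i, hlen ▸ hi⟩)
  rw [mem_positions, mem_positions, List.getElem?_eq_getElem hi, List.getElem?_eq_getElem hi',
    Option.some_inj, Option.some_inj] at hU
  rcases DyckStep.dichotomy w.toList[i] with h1 | h1 <;>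
  rcases DyckStep.dichotomy w'.toList[i] with h2 | h2 <;> simp_all

theorem four_pow_le_catalan (j : ℕ) : 4 ^ j ≤ 2 * (j + 1) ^ 2 * catalan j := by
  have h : 4 ^ j ≤ 2 * (j + 1) * j.centralBinom := by
    rcases Nat.eq_zero_or_pos j with rfl | hj
    · simp
    · exact (Nat.four_pow_le_two_mul_self_mul_centralBinom j hj).trans
        (Nat.mul_le_mul_right _ (by omega))
  calc 4 ^ j ≤ 2 * (j + 1) * j.centralBinom := h
    _ = 2 * (j + 1) ^ 2 * catalan j := by rw [← succ_mul_catalan_eq_centralBinom]; ring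

/-- At least half of the subsets of a nonempty type have an even number of elements. -/
theorem two_pow_le_card_even (hm : 0 < m) :
    2 ^ m ≤ 2 * ((Finset.univ : Finset (Finset (Fin m))).filter fun T => Even T.card).card := by
  classical
  have hodd : ((Finset.univ : Finset (Finset (Fin m))).filter fun T => ¬ Even T.card).card ≤
      ((Finset.univ : Finset (Finset (Fin m))).filter fun T => Even T.card).card := by
    let z : Fin m := ⟨0, hm⟩
    -- Toggling one point changes the parity.
    refine Finset.card_le_card_of_injOn (fun T => symmDiff T {z}) (fun T hT => ?_)
      (fun T _ S _ h => symmDiff_left_injective {z} h)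
    simp only [Finset.coe_filter, Finset.mem_univ, true_and, Set.mem_ofPred_eq] at hT ⊢
    by_cases hz : z ∈ T
    · have : symmDiff T {z} = T.erase z := by
        ext d; simp only [Finset.mem_symmDiff, Finset.mem_singleton, Finset.mem_erase]
        grind
      rw [this, Finset.card_erase_of_mem hz]
      have := Finset.card_pos.2 ⟨z, hz⟩
      grind
    · have : symmDiff T {z} = insert z T := by
        ext d; simp only [Finset.mem_symmDiff, Finset.mem_singleton, Finset.mem_insert]
        grind
      rw [this, Finset.card_insert_of_notMem hz]
      grind
  have := Finset.card_filter_add_card_filter_not (s := (Finset.univ : Finset (Finset (Fin m))))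
    (fun T => Even T.card)
  rw [Finset.card_univ, Fintype.card_finset, Fintype.card_fin] at this
  omega

end Ballot

/-! ### Lower bound for the number of codes. -/

section Count

variable {n : ℕ}

theorem exists_word_eq {T O O' : Finset (Fin (2 * n))} (hO : O ∈ openerSets T)
    (hO' : O' ∈ openerSets Tᶜ) : ∃ p q, IsCode p q ∧ word (p, q) = (T, O ∪ O') := by
  simp only [openerSets, Finset.mem_filter, Finset.mem_powerset] at hO hO'
  obtain ⟨hOT, p, hp, hnp, hp1, hp2⟩ := hO
  obtain ⟨hOT', q, hq, hnq, hq1, hq2⟩ := hO'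
  have hT : ∀ d, p d ≠ d ↔ d ∈ T := by
    intro d
    rw [← lt_or_lt_iff_ne, hp1, hp2, Finset.mem_sdiff]
    have := @hOT d
    tauto
  have hT' : ∀ d, q d ≠ d ↔ d ∉ T := by
    intro d
    rw [← lt_or_lt_iff_ne, hq1, hq2, Finset.mem_sdiff, Finset.mem_compl]
    have := @hOT' d
    rw [Finset.mem_compl] at this
    tauto
  refine ⟨p, q, ⟨hp, hq, hnp, hnq, fun d => ?_⟩, Prod.ext ?_ ?_⟩
  · rw [hT, ← not_iff_not, ← hT']
  · ext d; simp [word, hT]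
  · ext d; simp [word, hp1, hq1]

theorem four_pow_le_card_openerSets_mul {T : Finset (Fin (2 * n))} (hT : Even T.card) :
    4 ^ n ≤ 4 * (n + 1) ^ 4 * ((openerSets T).card * (openerSets Tᶜ).card) := by
  obtain ⟨j, hj⟩ := hT
  have hle : T.card ≤ 2 * n := by simpa using Finset.card_le_univ T
  have hj' : Tᶜ.card = 2 * (n - j) := by rw [Finset.card_compl, Fintype.card_fin]; omega
  have h1 := catalan_le_card_openerSets (hj.trans (two_mul j).symm)
  have h2 := catalan_le_card_openerSets hj'
  calc 4 ^ n = 4 ^ j * 4 ^ (n - j) := by rw [← pow_add]; congr 1; omega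
    _ ≤ (2 * (j + 1) ^ 2 * catalan j) * (2 * (n - j + 1) ^ 2 * catalan (n - j)) :=
      Nat.mul_le_mul (four_pow_le_catalan _) (four_pow_le_catalan _)
    _ ≤ (2 * (n + 1) ^ 2 * (openerSets T).card) * (2 * (n + 1) ^ 2 * (openerSets Tᶜ).card) := by
      gcongr <;> omega
    _ = _ := by ring

theorem openerSets_union_injOn (T : Finset (Fin (2 * n))) :
    Set.InjOn (fun P : Finset (Fin (2 * n)) × Finset (Fin (2 * n)) => P.1 ∪ P.2)
      (openerSets T ×ˢ openerSets Tᶜ : Finset _) := by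
  rintro ⟨A, B⟩ h ⟨A', B'⟩ h' heq
  simp only [openerSets, Finset.coe_product, Set.mem_prod, Finset.mem_coe, Finset.mem_filter,
    Finset.mem_powerset] at h h'
  have h1 := h.1.1
  have h2 := h.2.1
  have h3 := h'.1.1
  have h4 := h'.2.1
  simp only [Finset.ext_iff, Finset.mem_union, Finset.subset_iff, Finset.mem_compl,
    Prod.mk.injEq] at *
  exact ⟨fun d => by have := heq d; have := @h1 d; have := @h2 d; have := @h3 d
                     have := @h4 d; tauto,
    fun d => by have := heq d; have := @h1 d; have := @h2 d; have := @h3 d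
                have := @h4 d; tauto⟩

/-- Sum over the supports: at least half of the `4 ^ n` subsets are even, and each even one carries
at least `4 ^ n / (4 (n + 1) ^ 4)` words. -/
theorem sixteen_pow_le_card (hn : 0 < n)
    {R : Finset (Finset (Fin (2 * n)) × Finset (Fin (2 * n)))}
    (hR : ∀ p q, IsCode p q → word (p, q) ∈ R) : 16 ^ n ≤ 8 * (n + 1) ^ 4 * R.card := by
  classical
  set S := (Finset.univ : Finset (Finset (Fin (2 * n)))).filter fun T => Even T.card with hS
  have hfib : ∀ T, (openerSets T).card * (openerSets Tᶜ).card ≤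
      (R.filter fun P => P.1 = T).card := by
    intro T
    rw [← Finset.card_product]
    refine Finset.card_le_card_of_injOn (fun P => (T, P.1 ∪ P.2)) (fun P hP => ?_)
      (fun P hP P' hP' h => openerSets_union_injOn T hP hP' (congrArg Prod.snd h))
    obtain ⟨h1, h2⟩ := Finset.mem_product.1 (Finset.mem_coe.1 hP)
    obtain ⟨p, q, hc, hw⟩ := exists_word_eq h1 h2
    exact Finset.mem_coe.2 (Finset.mem_filter.2 ⟨(congrArg (· ∈ R) hw).mp (hR p q hc), rfl⟩)
  calc 16 ^ n = 2 ^ (2 * n) * 4 ^ n := by rw [pow_mul, ← mul_pow]; norm_num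
    _ ≤ 2 * S.card * 4 ^ n := Nat.mul_le_mul_right _ (two_pow_le_card_even (by omega))
    _ = 2 * ∑ T ∈ S, 4 ^ n := by rw [Finset.sum_const, smul_eq_mul]; ring
    _ ≤ 2 * ∑ T ∈ S, 4 * (n + 1) ^ 4 * (R.filter fun P => P.1 = T).card := by
      refine Nat.mul_le_mul_left _ (Finset.sum_le_sum fun T hT => ?_)
      exact (four_pow_le_card_openerSets_mul (Finset.mem_filter.1 hT).2).trans
        (Nat.mul_le_mul_left _ (hfib T))
    _ ≤ 2 * ∑ T, 4 * (n + 1) ^ 4 * (R.filter fun P => P.1 = T).card :=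
      Nat.mul_le_mul_left _ (Finset.sum_le_sum_of_subset (Finset.subset_univ _))
    _ = 8 * (n + 1) ^ 4 * R.card := by
      rw [← Finset.mul_sum, ← Finset.card_eq_sum_card_fiberwise (fun _ _ => Finset.mem_univ _)]
      ring

end Count

/-! ### Concentration of the support size and the resulting bound on the expectation. -/

section Concentration

variable {n : ℕ}

/-- The sum factors over the `2 * n` points as `(2 cosh (t / 2)) ^ (2 * n)`, and `cosh x ≤ exp (x² /
2)`. -/
theorem sum_exp_card_le (n : ℕ) (t : ℝ) :
    ∑ T : Finset (Fin (2 * n)), Real.exp (t * (T.card - n)) ≤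
      4 ^ n * Real.exp (t ^ 2 * n / 4) := by
  have h1 : ∑ T : Finset (Fin (2 * n)), Real.exp (t * (T.card - n)) =
      (Real.exp (t / 2) + Real.exp (-(t / 2))) ^ (2 * n) := by
    have := Finset.sum_pow_mul_eq_add_pow (Real.exp (t / 2)) (Real.exp (-(t / 2)))
      (Finset.univ : Finset (Fin (2 * n)))
    rw [Finset.powerset_univ, Finset.card_univ, Fintype.card_fin] at this
    rw [← this]
    refine Finset.sum_congr rfl fun T _ => ?_
    have hle : T.card ≤ 2 * n := by simpa using Finset.card_le_univ T
    rw [← Real.exp_nat_mul, ← Real.exp_nat_mul, ← Real.exp_add, Nat.cast_sub hle]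
    congr 1
    push_cast
    ring
  have h2 : Real.exp (t / 2) + Real.exp (-(t / 2)) = 2 * Real.cosh (t / 2) := by
    rw [Real.cosh_eq]; ring
  rw [h1, h2, mul_pow, pow_mul]
  have h3 : Real.cosh (t / 2) ^ (2 * n) ≤ Real.exp (t ^ 2 * n / 4) :=
    calc Real.cosh (t / 2) ^ (2 * n) ≤ Real.exp ((t / 2) ^ 2 / 2) ^ (2 * n) :=
        pow_le_pow_left₀ (Real.cosh_pos _).le (Real.cosh_le_exp_half_sq _) _
      _ = Real.exp (t ^ 2 * n / 4) := by
        rw [← Real.exp_nat_mul]; congr 1; push_cast; ring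
  norm_num
  exact h3

theorem card_deviation_le (n : ℕ) {δ : ℝ} (hδ : 0 < δ) :
    (((Finset.univ : Finset (Finset (Fin (2 * n)))).filter
      fun T => δ * n ≤ |(T.card : ℝ) - n|).card : ℝ) ≤ 2 * 4 ^ n * Real.exp (-(δ ^ 2 * n)) := by
  set B := (Finset.univ : Finset (Finset (Fin (2 * n)))).filter
    fun T => δ * n ≤ |(T.card : ℝ) - n|
  -- Chernoff bound with `t = ±2δ`; `t = 2δ` minimizes `t² n / 4 - t δ n`, with value `-δ² n`.
  have h1 : (B.card : ℝ) * Real.exp (2 * δ ^ 2 * n) ≤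
      ∑ T : Finset (Fin (2 * n)), (Real.exp ((2 * δ) * (T.card - n)) +
        Real.exp ((-(2 * δ)) * (T.card - n))) := by
    rw [← nsmul_eq_mul, ← Finset.sum_const]
    refine (Finset.sum_le_sum fun T hT => ?_).trans
      (Finset.sum_le_sum_of_subset_of_nonneg (Finset.subset_univ B) fun T _ _ => by positivity)
    have hT' := (Finset.mem_filter.1 hT).2
    rcases le_abs.1 hT' with h | h
    · have : Real.exp (2 * δ ^ 2 * n) ≤ Real.exp ((2 * δ) * (T.card - n)) :=
        Real.exp_le_exp.2 (by nlinarith)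
      linarith [Real.exp_pos ((-(2 * δ)) * ((T.card : ℝ) - n))]
    · have : Real.exp (2 * δ ^ 2 * n) ≤ Real.exp ((-(2 * δ)) * (T.card - n)) :=
        Real.exp_le_exp.2 (by nlinarith)
      linarith [Real.exp_pos ((2 * δ) * ((T.card : ℝ) - n))]
  have h2 : (B.card : ℝ) * Real.exp (2 * δ ^ 2 * n) ≤ 2 * 4 ^ n * Real.exp (δ ^ 2 * n) := by
    rw [Finset.sum_add_distrib] at h1
    have a1 := sum_exp_card_le n (2 * δ)
    have a2 := sum_exp_card_le n (-(2 * δ))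
    have e1 : (2 * δ) ^ 2 * n / 4 = δ ^ 2 * n := by ring
    have e2 : (-(2 * δ)) ^ 2 * n / 4 = δ ^ 2 * n := by ring
    rw [e1] at a1
    rw [e2] at a2
    linarith
  have h3 : 2 * 4 ^ n * Real.exp (δ ^ 2 * n) =
      (2 * 4 ^ n * Real.exp (-(δ ^ 2 * n))) * Real.exp (2 * δ ^ 2 * n) := by
    rw [mul_assoc _ (Real.exp _), ← Real.exp_add]; congr 2; ring
  rw [h3] at h2
  exact le_of_mul_le_mul_right h2 (Real.exp_pos _)

theorem integral_treeRootedLaw [Fintype (TreeRootedMap n)] (f : TreeRootedMap n → ℝ) :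
    ∫ x, f x ∂treeRootedLaw n = (∑ x, f x) / Fintype.card (TreeRootedMap n) := by
  have : MeasurableSingletonClass (TreeRootedMap n) := ⟨fun _ => trivial⟩
  rw [treeRootedLaw, uniformOn, ProbabilityTheory.cond, Measure.restrict_univ,
    integral_smul_measure, integral_count]
  simp [div_eq_inv_mul]

theorem abs_rpow_sub_one_le {k y : ℝ} {n : ℕ} (hk : 0 < k) (hn : 0 < n) (hy : 0 ≤ y)
    (hyn : y ≤ n) : |y ^ k - 1| ≤ (n : ℝ) ^ k := by
  have h1 : (1 : ℝ) ≤ (n : ℝ) ^ k :=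
    Real.one_le_rpow (by exact_mod_cast hn) hk.le
  have h2 : y ^ k ≤ (n : ℝ) ^ k := Real.rpow_le_rpow hy hyn hk.le
  have h3 : 0 ≤ y ^ k := Real.rpow_nonneg hy k
  rw [abs_le]
  constructor <;> linarith

/-- Maps with `|T|` within `δ n` of `n` cost at most `ε` each. The others cost at most `n ^ k` each,
and their proportion is bounded by the Chernoff count over the lower bound on the number of maps. -/
theorem abs_integral_sub_one_le {k δ ε : ℝ} (hk : 0 < k) (hδ : 0 < δ) (hε : 0 ≤ ε) (hn : 0 < n)
    (h : ∀ t : ℕ, |(t : ℝ) - n| < δ * n → |((n : ℝ) / (t + 2)) ^ k - 1| ≤ ε) :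
    |∫ x : TreeRootedMap n,
        ((x.1.numEdges : ℝ) / (2 * (x.1.numVertices : ℝ))) ^ k ∂(treeRootedLaw n) - 1| ≤
      ε + 256 * ((n : ℝ) ^ (k + 4) * Real.exp (-(δ ^ 2) * n)) := by
  classical
  obtain ⟨Φ, hΦ, hV, hsurj⟩ := exists_encoding n
  have : Finite (TreeRootedMap n) := Finite.of_injective Φ hΦ
  cases nonempty_fintype (TreeRootedMap n)
  have hcard := sixteen_pow_le_card (R := Finset.univ.image Φ) hn fun p q hc => by
    obtain ⟨x, hx⟩ := hsurj hn p q hc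
    exact Finset.mem_image.2 ⟨x, Finset.mem_univ _, hx⟩
  rw [Finset.card_image_of_injective _ hΦ, Finset.card_univ] at hcard
  set N := Fintype.card (TreeRootedMap n)
  have hcard' : (16 : ℝ) ^ n ≤ 8 * ((n : ℝ) + 1) ^ 4 * N := by exact_mod_cast hcard
  have hN : (0 : ℝ) < N := by
    rcases Nat.eq_zero_or_pos N with h0 | h0
    · rw [h0] at hcard
      have : 0 < 16 ^ n := by positivity
      omega
    · exact_mod_cast h0
  have hV' : ∀ x : TreeRootedMap n, 2 * (x.1.numVertices : ℝ) = (Φ x).1.card + 2 := fun x => by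
    exact_mod_cast hV x
  have hn1 : (1 : ℝ) ≤ n := by exact_mod_cast hn
  set B := (Finset.univ : Finset (Finset (Fin (2 * n)))).filter
    fun T => δ * n ≤ |(T.card : ℝ) - n|
  have hterm : ∀ x : TreeRootedMap n,
      |((x.1.numEdges : ℝ) / (2 * (x.1.numVertices : ℝ))) ^ k - 1| ≤
        ε + if (Φ x).1 ∈ B then (n : ℝ) ^ k else 0 := by
    intro x
    rw [hV', RootedPlanarMap.numEdges_eq]
    split_ifs with hx
    · have := abs_rpow_sub_one_le hk hn (y := (n : ℝ) / ((Φ x).1.card + 2)) (by positivity)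
        (div_le_self (by positivity) (by
          have : (0 : ℝ) ≤ (Φ x).1.card := Nat.cast_nonneg _
          linarith))
      linarith
    · rw [add_zero]
      refine h _ (not_le.1 fun hle => hx ?_)
      exact Finset.mem_filter.2 ⟨Finset.mem_univ _, hle⟩
  have hbad : ((Finset.univ.filter fun x => (Φ x).1 ∈ B).card : ℝ) ≤
      2 * 16 ^ n * Real.exp (-(δ ^ 2 * n)) := by
    have h1 : (Finset.univ.filter fun x => (Φ x).1 ∈ B).card ≤ B.card * 4 ^ n := by
      calc (Finset.univ.filter fun x => (Φ x).1 ∈ B).card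
          ≤ (B ×ˢ (Finset.univ : Finset (Finset (Fin (2 * n))))).card := by
            refine Finset.card_le_card_of_injOn Φ (fun x hx => ?_) hΦ.injOn
            have := (Finset.mem_filter.1 (Finset.mem_coe.1 hx)).2
            simpa using this
        _ = B.card * 4 ^ n := by
          rw [Finset.card_product, Finset.card_univ, Fintype.card_finset, Fintype.card_fin,
            pow_mul]
          norm_num
    have h2 : ((Finset.univ.filter fun x => (Φ x).1 ∈ B).card : ℝ) ≤ B.card * 4 ^ n := by
      exact_mod_cast h1
    calc ((Finset.univ.filter fun x => (Φ x).1 ∈ B).card : ℝ) ≤ B.card * 4 ^ n := h2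
      _ ≤ (2 * 4 ^ n * Real.exp (-(δ ^ 2 * n))) * 4 ^ n :=
        mul_le_mul_of_nonneg_right (card_deviation_le n hδ) (by positivity)
      _ = 2 * 16 ^ n * Real.exp (-(δ ^ 2 * n)) := by
        rw [show (16 : ℝ) = 4 * 4 by norm_num, mul_pow]; ring
  have hsum : ∑ x : TreeRootedMap n,
      |((x.1.numEdges : ℝ) / (2 * (x.1.numVertices : ℝ))) ^ k - 1| ≤
        N * ε + (2 * 16 ^ n * Real.exp (-(δ ^ 2 * n))) * (n : ℝ) ^ k := by
    refine (Finset.sum_le_sum fun x _ => hterm x).trans ?_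
    rw [Finset.sum_add_distrib, Finset.sum_const, Finset.card_univ, nsmul_eq_mul,
      ← Finset.sum_filter, Finset.sum_const, nsmul_eq_mul]
    gcongr
  -- From `n + 1 ≤ 2 n`: the constant is `8 * 2 ^ 4`, and the factor 2 of the two-sided deviation
  -- makes it 256.
  have hN2 : (16 : ℝ) ^ n ≤ 128 * (n : ℝ) ^ 4 * N := by
    refine hcard'.trans ?_
    have : ((n : ℝ) + 1) ^ 4 ≤ (2 * n) ^ 4 := pow_le_pow_left₀ (by positivity) (by linarith) 4
    nlinarith
  have hpow : (n : ℝ) ^ (k + 4) = (n : ℝ) ^ k * (n : ℝ) ^ 4 := by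
    rw [Real.rpow_add (by linarith)]
    congr 1
    exact_mod_cast Real.rpow_natCast (n : ℝ) 4
  rw [integral_treeRootedLaw]
  have e1 : (∑ x : TreeRootedMap n,
      ((x.1.numEdges : ℝ) / (2 * (x.1.numVertices : ℝ))) ^ k) / N - 1 =
      (∑ x : TreeRootedMap n,
        (((x.1.numEdges : ℝ) / (2 * (x.1.numVertices : ℝ))) ^ k - 1)) / N := by
    rw [Finset.sum_sub_distrib, Finset.sum_const, Finset.card_univ, nsmul_eq_mul, mul_one,
      sub_div, div_self hN.ne']
  rw [e1, abs_div, abs_of_pos hN, div_le_iff₀ hN, hpow, neg_mul]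
  refine (Finset.abs_sum_le_sum_abs _ _).trans (hsum.trans ?_)
  have hE : 0 ≤ Real.exp (-(δ ^ 2 * n)) * (n : ℝ) ^ k := by positivity
  nlinarith [mul_le_mul_of_nonneg_left hN2 hE]

end Concentration

/-! ### The limit. -/

theorem lemma5p1 (k : ℝ) (hk : 0 < k) :
    Tendsto
      (fun n : ℕ => ∫ x : TreeRootedMap n,
        ((x.1.numEdges : ℝ) / (2 * (x.1.numVertices : ℝ))) ^ k ∂(treeRootedLaw n))
      atTop (𝓝 1) := by
  rw [Metric.tendsto_atTop']
  intro ε hε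
  -- Applied at `y = (t + 2) / n` with `t = |T|`. Half of the tolerance `η` goes to the deviation of
  -- `t` (`δ = η / 2`); the other half absorbs the shift by 2, hence `4 / η < n`.
  have hcont : ContinuousAt (fun y : ℝ => (y⁻¹) ^ k) 1 :=
    (continuousAt_inv₀ one_ne_zero).rpow_const (Or.inl (by simp))
  obtain ⟨η, hη, hηε⟩ := Metric.continuousAt_iff.1 hcont (ε / 2) (by positivity)
  have hlim : Tendsto (fun n : ℕ => 256 * ((n : ℝ) ^ (k + 4) *
      Real.exp (-((η / 2) ^ 2) * n))) atTop (𝓝 (256 * 0)) :=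
    ((tendsto_rpow_mul_exp_neg_mul_atTop_nhds_zero (k + 4) ((η / 2) ^ 2) (by positivity)).comp
      tendsto_natCast_atTop_atTop).const_mul 256
  rw [mul_zero] at hlim
  have hev := hlim.eventually (gt_mem_nhds (half_pos hε))
  have hlarge : ∀ᶠ n : ℕ in atTop, 4 / η < n :=
    tendsto_natCast_atTop_atTop.eventually (eventually_gt_atTop (4 / η))
  obtain ⟨n₀, hn₀⟩ := eventually_atTop.1 (hev.and (hlarge.and (eventually_gt_atTop 0)))
  refine ⟨n₀, fun n hn => ?_⟩
  obtain ⟨h1, h2, hpos⟩ := hn₀ n hn.le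
  have hnR : (0 : ℝ) < n := by exact_mod_cast hpos
  rw [Real.dist_eq]
  refine (abs_integral_sub_one_le hk (half_pos hη) (half_pos hε).le hpos fun t ht => ?_).trans_lt
    (by linarith)
  have hclose : dist (((t : ℝ) + 2) / n) 1 < η := by
    have e : ((t : ℝ) + 2) / n - 1 = ((t - n) + 2) / n := by field_simp; ring
    rw [Real.dist_eq, e, abs_div, abs_of_pos hnR, div_lt_iff₀ hnR]
    rw [div_lt_iff₀ hη] at h2
    calc |(t : ℝ) - n + 2| ≤ |(t : ℝ) - n| + |2| := abs_add_le _ _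
      _ < η * n := by rw [abs_two]; nlinarith
  have := hηε hclose
  simp only [inv_div, inv_one, Real.one_rpow, Real.dist_eq] at this
  exact this.le
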